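/- Let $n\ge 1$ and $0<s<1$. For $t>0$ let $P_t(x)=P(x,t;s)=(2\pi)^{-n}\int_{\mathbb R^n}e^{i x\cdot\xi}e^{-t|\xi|^{2s}}\,d\xi$ be the fundamental solution of the fractional heat equation $\partial_t u+(-\Delta)^s u=0$ in $\mathbb R^n$, where $(-\Delta)^s$ is the Fourier multiplier with symbol $|\xi|^{2s}$. Let $u_0\in L^1(\mathbb R^n)$ be a real function (of any sign) with compact support, let $M=\int u_0(y)\,dy$ and $\mathcal N_{1,i}(u_0)=\int y_i\,u_0(y)\,dy$ for $1\le i\le n$. Let $u$ be the finite-mass weak solution with initial datum $u_0$, that is: $u$ is continuous on $(0,\infty)\times\mathbb R^n$, $u\in L^1((0,T)\times\mathbb R^n)$ for all $T>0$, and $$\int_0^\infty\!\!\int_{\mathbb R^n}u\,\bigl(\partial_t\varphi-(-\Delta)^s\varphi\bigr)\,dx\,dt+\int_{\mathbb R^n}u_0(x)\,\varphi(x,0)\,dx=0\qquad\text{for all }\varphi\in C_c^\infty(\mathbb R^n\times\mathbb R).$$ Then $$t^{1/(2s)}\,\frac{\bigl|u(x,t)-M P_t(x)+\sum_{i=1}^n\mathcal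 N_{1,i}(u_0)\,\partial_iP_t(x)\bigr|}{P_t(x)}\longrightarrow 0\qquad\text{as }t\to\infty,\text{ uniformly in }x\in\mathbb R^n .$$ In other words, $u(x,t)=M P_t(x)-\sum_{i=1}^n\mathcal N_{1,i}(u_0)\,\partial_iP_t(x)+o(t^{-1/(2s)})\,P_t(x)$ as $t\to\infty$, uniformly in $x\in\mathbb R^n$. -/

import Mathlib

noncomputable section

namespace FractionalHeat

open MeasureTheory Set Function
open scoped FourierTransform ContDiff

/-- Euclidean space `ℝⁿ`. -/
abbrev E (n : ℕ) : Type := EuclideanSpace ℝ (Fin n)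

/-- The fundamental solution `P_t(x) = P(x,t;s)` of the fractional heat equation: the inverse
Fourier transform of `ξ ↦ exp (-t |ξ|^(2s))`. Mathlib's transform uses the character
`exp (2πi⟨x,ξ⟩)`, so the frequency variable is rescaled by `2π`. The transform is real valued,
so taking the real part only changes the codomain. -/
def kernel {n : ℕ} (s t : ℝ) (x : E n) : ℝ :=
  (𝓕⁻ (fun ξ : E n => ((Real.exp (-(t * (2 * Real.pi * ‖ξ‖) ^ (2 * s))) : ℝ) : ℂ)) x).re

/-- The fractional Laplacian `(-Δ)^s f`, for real test functions `f`: the Fourier multiplier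
with symbol `|ξ|^(2s)` (again with frequencies rescaled by `2π`). -/
def fracLaplacian {n : ℕ} (s : ℝ) (f : E n → ℝ) (x : E n) : ℝ :=
  (𝓕⁻ (fun ξ : E n => (((2 * Real.pi * ‖ξ‖) ^ (2 * s) : ℝ) : ℂ) *
    𝓕 (fun y : E n => ((f y : ℝ) : ℂ)) ξ) x).re

/-- `u` is the (continuous for `t > 0`, finite-mass) weak solution of the Cauchy problem
`∂ₜu + (-Δ)^s u = 0` in `(0,∞) × ℝⁿ`, `u(0) = u₀`. The values of `u` at times `t ≤ 0` play no
role; the initial datum is encoded in the weak formulation, whose test functions need not vanish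
at `t = 0`. -/
structure IsWeakSolution {n : ℕ} (s : ℝ) (u₀ : E n → ℝ) (u : ℝ → E n → ℝ) : Prop where
  /-- `u` is the continuous representative on `(0,∞) × ℝⁿ`. -/
  continuousOn : ContinuousOn (uncurry u) (Ioi (0 : ℝ) ×ˢ (univ : Set (E n)))
  /-- `u ∈ L¹((0,T) × ℝⁿ)` for every finite `T`. -/
  integrableOn : ∀ T : ℝ, 0 < T →
    IntegrableOn (uncurry u) (Ioo (0 : ℝ) T ×ˢ (univ : Set (E n)))
  /-- The equation and the initial datum, tested against `φ ∈ C_c^∞(ℝ × ℝⁿ)`. -/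
  weak : ∀ φ : ℝ × E n → ℝ, ContDiff ℝ ∞ φ → HasCompactSupport φ →
    (∫ t in Ioi (0 : ℝ), ∫ x : E n,
        u t x * (deriv (fun τ => φ (τ, x)) t - fracLaplacian s (fun y => φ (t, y)) x))
      + ∫ x : E n, u₀ x * φ (0, x) = 0

/-- The mass `M = ∫ u₀`. -/
def mass {n : ℕ} (u₀ : E n → ℝ) : ℝ := ∫ y : E n, u₀ y

/-- The first moments `N_{1,i}(u₀) = ∫ yᵢ u₀(y) dy`. -/
def firstMoment {n : ℕ} (u₀ : E n → ℝ) (i : Fin n) : ℝ := ∫ y : E n, y i * u₀ y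

/-- The partial derivative `∂ᵢ f`. -/
def partialDeriv {n : ℕ} (i : Fin n) (f : E n → ℝ) (x : E n) : ℝ :=
  fderiv ℝ f x (EuclideanSpace.single i 1)

/-- The remainder `u(x,t) - M P_t(x) + ∑ᵢ N_{1,i}(u₀) ∂ᵢP_t(x)`. -/
def remainder {n : ℕ} (s : ℝ) (u₀ : E n → ℝ) (u : ℝ → E n → ℝ) (t : ℝ) (x : E n) : ℝ :=
  u t x - mass u₀ * kernel s t x
    + ∑ i : Fin n, firstMoment u₀ i * partialDeriv i (kernel s t) x

end FractionalHeat

end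

noncomputable section

namespace FractionalHeat

open MeasureTheory Set Function Filter Topology
open scoped FourierTransform ContDiff

/-! ### The one-sided stable law of index `s` -/

/-! The kernel satisfies a second order Taylor estimate whose error is measured by the kernel
itself: the remainder of `P_t(x - y)` at `x` is at most `C (|y| t^(-1/(2s)))^2 P_t(x)` once `|y| ≤
t^(1/(2s))` (`exists_kernel_taylor`). Since `u` is the convolution of `u₀` with `P_t`, the mass and
first moments account exactly for the terms of order zero and one, so `remainder` is the integral of
the Taylor remainder against `u₀`. Compact support then gives `O(t^(-1/s)) P_t(x)`, one factor
`t^(-1/(2s))` better than required.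

The relative Taylor estimate comes from subordination. The function `exp(-λ^s)` is the Laplace
transform of a probability measure `η` on `(0,∞)`, the one-sided stable law (`exists_stable_law`),
so `P_1` is the `η`-mixture of Gaussians (`kernel_one`). Each Gaussian is expanded explicitly. The
errors integrate to at most a multiple of `P_1(z)`, because the Laplace transform of `η` bounds them
above while a lower bound on `η`-masses gives `P_1(z) ≥ c ρ^(-(n+2s))` for `ρ ≥ max(1,|z|)`
(`exists_le_integral_gauss`). Scaling transfers the estimate to every `t`.

The convolution formula (`eq_integral_kernel`) is a uniqueness theorem. Testing the weak equation
against truncated plane waves shows that every Fourier mode of `u` solves `W' = -|ξ|^(2s) W` weakly,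
hence decays exponentially from its initial value. Fourier inversion and the continuity of `u`
finish the identification. -/

/-- The profile `v ↦ 1 - exp (-v^(-1/s))` of the Laplace exponent of `U^(-1/s)`, `U` uniform. -/
def stableProfile (s v : ℝ) : ℝ := 1 - Real.exp (-v ^ (-1 / s))

lemma stableProfile_nonneg {s v : ℝ} (hv : 0 ≤ v) : 0 ≤ stableProfile s v := by
  have : Real.exp (-v ^ (-1 / s)) ≤ 1 := by
    rw [Real.exp_le_one_iff]; have := Real.rpow_nonneg hv (-1 / s); linarith
  unfold stableProfile; linarith

lemma stableProfile_pos {s v : ℝ} (hv : 0 < v) : 0 < stableProfile s v := by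
  have : Real.exp (-v ^ (-1 / s)) < 1 := by
    rw [Real.exp_lt_one_iff]; have := Real.rpow_pos_of_pos hv (-1 / s); linarith
  unfold stableProfile; linarith

lemma stableProfile_le_one {s v : ℝ} : stableProfile s v ≤ 1 := by
  unfold stableProfile; linarith [Real.exp_pos (-v ^ (-1 / s))]

lemma stableProfile_le_rpow {s v : ℝ} : stableProfile s v ≤ v ^ (-1 / s) := by
  unfold stableProfile; linarith [Real.add_one_le_exp (-v ^ (-1 / s))]

lemma measurable_stableProfile (s : ℝ) : Measurable (stableProfile s) := by
  unfold stableProfile; fun_prop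

lemma integrableOn_stableProfile {s : ℝ} (hs0 : 0 < s) (hs1 : s < 1) :
    IntegrableOn (stableProfile s) (Ioi 0) := by
  rw [← Ioc_union_Ioi_eq_Ioi (zero_le_one (α := ℝ))]
  refine IntegrableOn.union ?_ ?_
  · refine Measure.integrableOn_of_bounded (M := 1) (by simp)
      (measurable_stableProfile s).aestronglyMeasurable ?_
    refine ae_restrict_of_forall_mem measurableSet_Ioc fun v hv => ?_
    rw [Real.norm_of_nonneg (stableProfile_nonneg hv.1.le)]
    exact stableProfile_le_one
  -- This is where `s < 1` enters: the bound `v^(-1/s)` is integrable at infinity.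
  · have hlt : -1 / s < -1 := by rw [div_lt_iff₀ hs0]; linarith
    refine (integrableOn_Ioi_rpow_of_lt hlt zero_lt_one).mono'
      (measurable_stableProfile s).aestronglyMeasurable ?_
    refine ae_restrict_of_forall_mem measurableSet_Ioi fun v hv => ?_
    rw [Real.norm_of_nonneg (stableProfile_nonneg (zero_lt_one.trans hv).le)]
    exact stableProfile_le_rpow

lemma integral_stableProfile_pos {s : ℝ} (hs0 : 0 < s) (hs1 : s < 1) :
    0 < ∫ v in Ioi 0, stableProfile s v := by
  rw [setIntegral_pos_iff_support_of_nonneg_ae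
    (ae_restrict_of_forall_mem measurableSet_Ioi fun v hv => stableProfile_nonneg (le_of_lt hv))
    (integrableOn_stableProfile hs0 hs1)]
  have : support (stableProfile s) ∩ Ioi 0 = Ioi 0 :=
    inter_eq_right.2 fun v hv => (stableProfile_pos hv).ne'
  simp [this]

/-- The Laplace transform of `U^(-1/s)`, `U` uniform on `[0,1]`. -/
lemma integral_exp_neg_mul_rpow_unitInterval {s κ : ℝ} (hs0 : 0 < s) (hκ : 0 < κ) :
    ∫ x : unitInterval, Real.exp (-(κ * (x : ℝ) ^ (-1 / s)))
      = 1 - κ ^ s * ∫ v in Ioc 0 (κ ^ (-s)), stableProfile s v := by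
  have h1 : ∫ x : unitInterval, Real.exp (-(κ * (x : ℝ) ^ (-1 / s)))
      = ∫ x in (0 : ℝ)..1, Real.exp (-(κ * x ^ (-1 / s))) := by
    rw [intervalIntegral.integral_of_le zero_le_one, ← integral_Icc_eq_integral_Ioc]
    exact integral_subtype_comap measurableSet_Icc fun x : ℝ => Real.exp (-(κ * x ^ (-1 / s)))
  have hκs : 0 < κ ^ (-s) := Real.rpow_pos_of_pos hκ _
  have hint : IntervalIntegrable (fun x : ℝ => Real.exp (-(κ * x ^ (-1 / s)))) volume 0 1 := by
    rw [intervalIntegrable_iff_integrableOn_Ioc_of_le zero_le_one]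
    refine Measure.integrableOn_of_bounded (M := 1) (by simp)
      (by fun_prop : Measurable _).aestronglyMeasurable ?_
    refine ae_restrict_of_forall_mem measurableSet_Ioc fun v hv => ?_
    rw [Real.norm_of_nonneg (Real.exp_pos _).le, Real.exp_le_one_iff]
    have := Real.rpow_nonneg hv.1.le (-1 / s)
    have := mul_nonneg hκ.le this
    linarith
  have h2 : ∫ x in (0 : ℝ)..1, (1 - Real.exp (-(κ * x ^ (-1 / s))))
      = κ ^ s * ∫ v in Ioc 0 (κ ^ (-s)), stableProfile s v := by
    -- Substitution `v = κ^(-s) x`: since `(κ^(-s))^(-1/s) = κ`, the scale `κ` is absorbed into the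
    -- profile.
    have := intervalIntegral.integral_comp_mul_left (a := 0) (b := 1) (stableProfile s) hκs.ne'
    rw [mul_zero, mul_one, intervalIntegral.integral_of_le hκs.le, ← Real.rpow_neg hκ.le,
      neg_neg, smul_eq_mul] at this
    rw [← this]
    refine intervalIntegral.integral_congr fun x hx => ?_
    rw [uIcc_of_le zero_le_one] at hx
    simp only [stableProfile]
    rw [Real.mul_rpow hκs.le hx.1, ← Real.rpow_mul hκ.le]
    have : -s * (-1 / s) = 1 := by field_simp
    rw [this, Real.rpow_one]
  rw [intervalIntegral.integral_sub (by simp) hint] at h2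
  simp only [intervalIntegral.integral_const, sub_zero, smul_eq_mul, mul_one] at h2
  rw [h1]; linarith

/-- `exp (-(β ∑ᵢ Uᵢ^(-1/s)))` for independent uniform `Uᵢ`. -/
def stableApprox (s β : ℝ) (hβ : 0 ≤ β) (N : ℕ) (w : Fin N → unitInterval) : unitInterval :=
  ⟨Real.exp (-(β * ∑ i, (w i : ℝ) ^ (-1 / s))), (Real.exp_pos _).le, by
    rw [Real.exp_le_one_iff]
    have : 0 ≤ ∑ i, (w i : ℝ) ^ (-1 / s) :=
      Finset.sum_nonneg fun i _ => Real.rpow_nonneg (w i).2.1 _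
    have := mul_nonneg hβ this
    linarith⟩

lemma measurable_stableApprox (s β : ℝ) (hβ : 0 ≤ β) (N : ℕ) :
    Measurable (stableApprox s β hβ N) := by
  refine Measurable.subtype_mk ?_
  fun_prop

/-- Raising `exp(-X)` to the power `lam` gives `exp(-lam X)`, and independence factors its
expectation. -/
lemma integral_stableApprox_rpow {s β lam : ℝ} (hs0 : 0 < s) (hβ : 0 < β) (hlam : 0 < lam)
    (N : ℕ) :
    ∫ w, ((stableApprox s β hβ.le N w : unitInterval) : ℝ) ^ lam ∂(Measure.pi fun _ => volume)
      = (1 - (lam * β) ^ s * ∫ v in Ioc 0 ((lam * β) ^ (-s)), stableProfile s v) ^ N := by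
  rw [← integral_exp_neg_mul_rpow_unitInterval hs0 (mul_pos hlam hβ)]
  have := integral_fintype_prod_eq_pow (ι := Fin N) (μ := (volume : Measure unitInterval))
    (fun x : unitInterval => Real.exp (-(lam * β * (x : ℝ) ^ (-1 / s))))
  rw [Fintype.card_fin] at this
  rw [← this]
  refine integral_congr_ae (.of_forall fun w => ?_)
  simp only [stableApprox]
  rw [← Real.exp_mul, ← Real.exp_sum, Finset.sum_neg_distrib, ← Finset.mul_sum]
  ring_nf

/-- `U^(-1/s)` has tail `x^(-s)`, so a sum of `N` independent copies lives at scale `N^(1/s)`. With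
the normalisation `(N c)^(-1/s)` each factor is `1 - lam^s/N + o(1/N)`. The shift to `N + 1` keeps
the scale positive. -/
lemma tendsto_laplace_stableApprox {s lam : ℝ} (hs0 : 0 < s) (hs1 : s < 1) (hlam : 0 < lam) :
    Tendsto (fun N : ℕ => (1 - (lam * ((N + 1 : ℕ) * ∫ v in Ioi 0, stableProfile s v) ^ (-1 / s)) ^ s
        * ∫ v in Ioc 0 ((lam * ((N + 1 : ℕ) * ∫ v in Ioi 0, stableProfile s v) ^ (-1 / s)) ^ (-s)),
          stableProfile s v) ^ (N + 1)) atTop (𝓝 (Real.exp (-lam ^ s))) := by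
  set c := ∫ v in Ioi 0, stableProfile s v with hc
  have hcpos : 0 < c := integral_stableProfile_pos hs0 hs1
  have key : ∀ N : ℕ, (lam * ((N + 1 : ℕ) * c) ^ (-1 / s)) ^ s = lam ^ s / ((N + 1 : ℕ) * c) := by
    intro N
    have hN : 0 < ((N + 1 : ℕ) : ℝ) * c := by positivity
    rw [Real.mul_rpow hlam.le (by positivity), ← Real.rpow_mul hN.le]
    have : -1 / s * s = -1 := by field_simp
    rw [this, Real.rpow_neg_one, div_eq_mul_inv]
  have key' : ∀ N : ℕ, (lam * ((N + 1 : ℕ) * c) ^ (-1 / s)) ^ (-s)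
      = ((N + 1 : ℕ) : ℝ) * (c / lam ^ s) := by
    intro N
    have hN : 0 < ((N + 1 : ℕ) : ℝ) * c := by positivity
    rw [Real.rpow_neg (by positivity), key, inv_div, mul_div_assoc]
  simp only [key, key']
  have hlim : Tendsto (fun N : ℕ => ∫ v in Ioc 0 ((N : ℝ) * (c / lam ^ s)), stableProfile s v)
      atTop (𝓝 c) := by
    have := intervalIntegral_tendsto_integral_Ioi 0 (integrableOn_stableProfile hs0 hs1)
      ((tendsto_natCast_atTop_atTop (R := ℝ)).atTop_mul_const
        (show 0 < c / lam ^ s by positivity))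
    refine this.congr fun N => ?_
    rw [intervalIntegral.integral_of_le (by positivity)]
  have := Real.tendsto_one_add_pow_exp_of_tendsto
    (g := fun N : ℕ => -(lam ^ s / ((N : ℝ) * c)
      * ∫ v in Ioc 0 ((N : ℝ) * (c / lam ^ s)), stableProfile s v)) (t := -lam ^ s) ?_
  · refine (this.comp (tendsto_add_atTop_nat 1)).congr fun N => ?_
    simp [sub_eq_add_neg]
  · have h2 := (hlim.const_mul (lam ^ s / c)).neg
    rw [div_mul_cancel₀ _ hcpos.ne'] at h2
    refine h2.congr' ?_
    filter_upwards [eventually_gt_atTop 0] with N hN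
    have : (N : ℝ) ≠ 0 := by positivity
    field_simp

/-- There is a probability measure on `[0,1]` with Mellin transform `exp (-lam^s)`. -/
lemma exists_probabilityMeasure_unitInterval {s : ℝ} (hs0 : 0 < s) (hs1 : s < 1) :
    ∃ μ : ProbabilityMeasure unitInterval, ∀ lam : ℝ, 0 < lam →
      ∫ z : unitInterval, (z : ℝ) ^ lam ∂(μ : Measure unitInterval) = Real.exp (-lam ^ s) := by
  set c := ∫ v in Ioi 0, stableProfile s v with hc
  have hcpos : 0 < c := integral_stableProfile_pos hs0 hs1
  have hβ : ∀ N : ℕ, 0 < (((N + 1 : ℕ) : ℝ) * c) ^ (-1 / s) := fun N => by positivity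
  let μN : ℕ → ProbabilityMeasure unitInterval := fun N =>
    ⟨(Measure.pi fun _ : Fin (N + 1) => (volume : Measure unitInterval)).map
      (stableApprox s _ (hβ N).le (N + 1)),
      Measure.isProbabilityMeasure_map (measurable_stableApprox _ _ _ _).aemeasurable⟩
  -- The variable `exp(-X)` was used instead of `X` so that the laws live on a compact space; a
  -- cluster point is enough because the Mellin transforms converge.
  obtain ⟨μ, hμ⟩ := exists_clusterPt_of_compactSpace (map μN atTop)
  refine ⟨μ, fun lam hlam => ?_⟩
  have hcont : Continuous fun z : unitInterval => (z : ℝ) ^ lam :=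
    continuous_subtype_val.rpow_const fun _ => Or.inr hlam.le
  let f : BoundedContinuousFunction unitInterval ℝ := BoundedContinuousFunction.mkOfCompact ⟨_, hcont⟩
  have hf : Continuous fun ν : ProbabilityMeasure unitInterval =>
      ∫ z, f z ∂(ν : Measure unitInterval) := by
    refine continuous_iff_continuousAt.2 fun ν => ?_
    exact ProbabilityMeasure.tendsto_iff_forall_integral_tendsto.1 tendsto_id f
  have hcl : MapClusterPt (∫ z, f z ∂(μ : Measure unitInterval)) atTop
      (fun N => ∫ z, f z ∂(μN N : Measure unitInterval)) :=
    MapClusterPt.continuousAt_comp hf.continuousAt hμ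
  have hlim : Tendsto (fun N => ∫ z, f z ∂(μN N : Measure unitInterval)) atTop
      (𝓝 (Real.exp (-lam ^ s))) := by
    refine (tendsto_laplace_stableApprox hs0 hs1 hlam).congr fun N => ?_
    rw [← integral_stableApprox_rpow hs0 (hβ N) hlam]
    exact (integral_map (measurable_stableApprox _ _ _ _).aemeasurable
      hcont.aestronglyMeasurable).symm
  exact eq_of_nhds_neBot (NeBot.mono hcl (inf_le_inf_left _ hlim))

/-- Existence of the one-sided stable law of index `s`. -/
theorem exists_stable_law {s : ℝ} (hs0 : 0 < s) (hs1 : s < 1) :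
    ∃ η : Measure ℝ, IsProbabilityMeasure η ∧ (∀ᵐ τ ∂η, 0 < τ) ∧
      ∀ lam : ℝ, 0 ≤ lam → ∫ τ, Real.exp (-(lam * τ)) ∂η = Real.exp (-lam ^ s) := by
  obtain ⟨μ, hμ⟩ := exists_probabilityMeasure_unitInterval hs0 hs1
  have hint : ∀ lam : ℝ, 0 < lam →
      Integrable (fun z : unitInterval => (z : ℝ) ^ lam) (μ : Measure unitInterval) := by
    intro lam hlam
    refine Integrable.of_bound (C := 1)
      (continuous_subtype_val.rpow_const fun _ => Or.inr hlam.le).aestronglyMeasurable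
      (.of_forall fun z => ?_)
    rw [Real.norm_of_nonneg (Real.rpow_nonneg z.2.1 _)]
    exact Real.rpow_le_one z.2.1 z.2.2 hlam.le
  -- No mass escapes to `τ = ∞`: compare the indicator of `0` with `1 - z^lam` and let `lam → 0`.
  have h0 : (μ : Measure unitInterval) {0} = 0 := by
    have hle : ∀ lam : ℝ, 0 < lam →
        (μ : Measure unitInterval).real {0} ≤ 1 - Real.exp (-lam ^ s) := by
      intro lam hlam
      rw [← hμ lam hlam]
      have h1 : (μ : Measure unitInterval).real {0}
          = ∫ z, indicator {0} 1 z ∂(μ : Measure unitInterval) := by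
        rw [integral_indicator_one (measurableSet_singleton _)]
      have h2 : ∫ z : unitInterval, (1 - (z : ℝ) ^ lam) ∂(μ : Measure unitInterval)
          = 1 - ∫ z : unitInterval, (z : ℝ) ^ lam ∂(μ : Measure unitInterval) := by
        rw [integral_sub (integrable_const _) (hint lam hlam)]; simp
      rw [h1, ← h2]
      refine integral_mono ((integrable_const (1 : ℝ)).indicator (measurableSet_singleton _))
        ((integrable_const _).sub (hint lam hlam)) fun z => ?_
      by_cases hz : z = 0
      · subst hz; simp [Real.zero_rpow hlam.ne']
      · simp [hz, Real.rpow_le_one z.2.1 z.2.2 hlam.le]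
    have hlim : Tendsto (fun lam : ℝ => 1 - Real.exp (-lam ^ s)) (𝓝[>] 0) (𝓝 0) := by
      have : ContinuousAt (fun lam : ℝ => 1 - Real.exp (-lam ^ s)) 0 := by
        have := Real.continuousAt_rpow_const 0 s (Or.inr hs0.le)
        fun_prop
      have h := this.tendsto
      simp only [Real.zero_rpow hs0.ne', neg_zero, Real.exp_zero, sub_self] at h
      exact h.mono_left nhdsWithin_le_nhds
    have := ge_of_tendsto hlim (eventually_nhdsWithin_of_forall fun lam hlam => hle lam hlam)
    exact (measureReal_eq_zero_iff (by simp)).1 (le_antisymm this measureReal_nonneg)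
  -- No mass sits at `τ = 0`: compare the indicator of `1` with `z^lam` and let `lam → ∞`.
  have h1 : (μ : Measure unitInterval) {1} = 0 := by
    have hle : ∀ lam : ℝ, 0 < lam →
        (μ : Measure unitInterval).real {1} ≤ Real.exp (-lam ^ s) := by
      intro lam hlam
      rw [← hμ lam hlam]
      have h1 : (μ : Measure unitInterval).real {1}
          = ∫ z, indicator {1} 1 z ∂(μ : Measure unitInterval) := by
        rw [integral_indicator_one (measurableSet_singleton _)]
      rw [h1]
      refine integral_mono ((integrable_const (1 : ℝ)).indicator (measurableSet_singleton _))
        (hint lam hlam) fun z => ?_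
      by_cases hz : z = 1
      · subst hz; simp
      · simp [hz, Real.rpow_nonneg z.2.1]
    have hlim : Tendsto (fun lam : ℝ => Real.exp (-lam ^ s)) atTop (𝓝 0) :=
      Real.tendsto_exp_atBot.comp (tendsto_neg_atTop_atBot.comp (tendsto_rpow_atTop hs0))
    have := ge_of_tendsto hlim ((eventually_gt_atTop 0).mono fun lam hlam => hle lam hlam)
    exact (measureReal_eq_zero_iff (by simp)).1 (le_antisymm this measureReal_nonneg)
  have hmeas : Measurable fun z : unitInterval => -Real.log (z : ℝ) := by fun_prop
  have hae : ∀ᵐ z : unitInterval ∂(μ : Measure unitInterval), 0 < (z : ℝ) ∧ (z : ℝ) < 1 := by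
    have h0' : ∀ᵐ z : unitInterval ∂(μ : Measure unitInterval), z ≠ 0 := by
      rw [ae_iff]; simpa using h0
    have h1' : ∀ᵐ z : unitInterval ∂(μ : Measure unitInterval), z ≠ 1 := by
      rw [ae_iff]; simpa using h1
    filter_upwards [h0', h1'] with z hz0 hz1
    exact ⟨unitInterval.pos_iff_ne_zero.2 hz0, unitInterval.lt_one_iff_ne_one.2 hz1⟩
  have hprob : IsProbabilityMeasure
      (Measure.map (fun z : unitInterval => -Real.log (z : ℝ)) (μ : Measure unitInterval)) :=
    Measure.isProbabilityMeasure_map hmeas.aemeasurable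
  refine ⟨_, hprob, ?_, fun lam hlam => ?_⟩
  · refine (ae_map_iff hmeas.aemeasurable (measurableSet_Ioi (a := (0 : ℝ)))).2 ?_
    filter_upwards [hae] with z hz
    have := Real.log_neg hz.1 hz.2
    linarith
  · rcases hlam.eq_or_lt with rfl | hlam
    · simp [Real.zero_rpow hs0.ne']
    · rw [← hμ lam hlam, integral_map hmeas.aemeasurable (by fun_prop)]
      refine integral_congr_ae ?_
      filter_upwards [hae] with z hz
      rw [Real.rpow_def_of_pos hz.1]
      ring_nf

/-! ### Tails and negative moments of the stable law -/

/-- `η` is the one-sided stable law of index `s`. -/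
structure IsStableLaw (s : ℝ) (η : Measure ℝ) : Prop where
  isProbabilityMeasure : IsProbabilityMeasure η
  ae_pos : ∀ᵐ τ ∂η, 0 < τ
  laplace : ∀ lam : ℝ, 0 ≤ lam → ∫ τ, Real.exp (-(lam * τ)) ∂η = Real.exp (-lam ^ s)

namespace IsStableLaw

variable {s : ℝ} {η : Measure ℝ}

lemma integrable_exp (h : IsStableLaw s η) {lam : ℝ} (hlam : 0 ≤ lam) :
    Integrable (fun τ => Real.exp (-(lam * τ))) η := by
  have := h.isProbabilityMeasure
  refine Integrable.of_bound (C := 1) (by fun_prop) ?_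
  filter_upwards [h.ae_pos] with τ hτ
  rw [Real.norm_of_nonneg (Real.exp_pos _).le, Real.exp_le_one_iff]
  have := mul_nonneg hlam hτ.le
  linarith

lemma integrable_one_sub_exp (h : IsStableLaw s η) {lam : ℝ} (hlam : 0 ≤ lam) :
    Integrable (fun τ => 1 - Real.exp (-(lam * τ))) η :=
  have := h.isProbabilityMeasure
  (integrable_const _).sub (h.integrable_exp hlam)

lemma integral_one_sub_exp (h : IsStableLaw s η) {lam : ℝ} (hlam : 0 ≤ lam) :
    ∫ τ, (1 - Real.exp (-(lam * τ))) ∂η = 1 - Real.exp (-lam ^ s) := by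
  have := h.isProbabilityMeasure
  rw [integral_sub (integrable_const _) (h.integrable_exp hlam), h.laplace lam hlam]
  simp

/-- This replaces an upper tail bound: `1 - exp(-lam τ)` is comparable to `min(1, lam τ)`. -/
lemma integral_one_sub_exp_le (h : IsStableLaw s η) {lam : ℝ} (hlam : 0 ≤ lam) :
    ∫ τ, (1 - Real.exp (-(lam * τ))) ∂η ≤ lam ^ s := by
  rw [h.integral_one_sub_exp hlam]
  linarith [Real.add_one_le_exp (-lam ^ s)]

/-- Write `Γ(p) τ^(-p)` as the integral of `lam^(p-1) exp(-lam τ)` over `lam > 0` and exchange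
integrals; the stretched exponential `exp(-lam^s)` makes the result finite. -/
lemma integrable_rpow_neg (h : IsStableLaw s η) (hs0 : 0 < s) {p : ℝ} (hp : 0 ≤ p) :
    Integrable (fun τ => τ ^ (-p)) η := by
  have := h.isProbabilityMeasure
  rcases hp.eq_or_lt with rfl | hp
  · simp
  have hI : Integrable (fun lam : ℝ => lam ^ (p - 1) * Real.exp (-lam ^ s))
      (volume.restrict (Ioi 0)) := by
    -- A non-integrable function has Bochner integral zero, whereas the known value is a positive
    -- Gamma factor.
    by_contra hcon
    have h1 := integral_undef hcon
    rw [integral_rpow_mul_exp_neg_rpow hs0 (by linarith)] at h1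
    have : 0 < Real.Gamma ((p - 1 + 1) / s) := Real.Gamma_pos_of_pos (by
      rw [sub_add_cancel]; positivity)
    have : 0 < 1 / s * Real.Gamma ((p - 1 + 1) / s) := by positivity
    exact this.ne' h1
  have hprod : Integrable (fun q : ℝ × ℝ => q.2 ^ (p - 1) * Real.exp (-(q.2 * q.1)))
      (η.prod (volume.restrict (Ioi 0))) := by
    rw [integrable_prod_iff' (by fun_prop)]
    constructor
    · refine ae_restrict_of_forall_mem measurableSet_Ioi fun lam hlam => ?_
      exact (h.integrable_exp (le_of_lt hlam)).const_mul (lam ^ (p - 1))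
    · refine hI.congr (ae_restrict_of_forall_mem measurableSet_Ioi fun lam hlam => ?_)
      have hlam : 0 < lam := hlam
      simp only
      rw [← h.laplace lam hlam.le, ← integral_const_mul]
      refine integral_congr_ae (.of_forall fun τ => ?_)
      simp only
      rw [Real.norm_of_nonneg]
      have := Real.rpow_nonneg hlam.le (p - 1)
      positivity
  have h2 := hprod.integral_prod_left.mul_const (Real.Gamma p)⁻¹
  refine h2.congr ?_
  filter_upwards [h.ae_pos] with τ hτ
  have hΓ := (Real.Gamma_pos_of_pos hp).ne'
  have := Real.integral_rpow_mul_exp_neg_mul_Ioi hp hτ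
  simp only [mul_comm τ] at this
  rw [this, mul_assoc, mul_inv_cancel₀ hΓ, mul_one, one_div, Real.inv_rpow hτ.le,
    Real.rpow_neg hτ.le]

lemma half_mul_le_one_sub_exp {x : ℝ} (h0 : 0 ≤ x) (h1 : x ≤ 1) : x / 2 ≤ 1 - Real.exp (-x) := by
  have h2 := Real.add_one_le_exp x
  have h3 : Real.exp (-x) * Real.exp x = 1 := by rw [← Real.exp_add]; simp
  have h4 : Real.exp (-x) ≤ 1 := by rw [Real.exp_le_one_iff]; linarith
  nlinarith [Real.exp_pos (-x)]

lemma half_le_one_sub_exp {x : ℝ} (h1 : 1 ≤ x) : 1 / 2 ≤ 1 - Real.exp (-x) := by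
  have h2 := half_mul_le_one_sub_exp zero_le_one le_rfl
  have : Real.exp (-x) ≤ Real.exp (-1) := Real.exp_le_exp.2 (by linarith)
  linarith

/-- The stable law charges dyadic-type blocks at least like `a ^ (-s)`. -/
lemma exists_le_measure_Ioc (h : IsStableLaw s η) (hs0 : 0 < s) (hs1 : s < 1) :
    ∃ c K : ℝ, 0 < c ∧ 1 ≤ K ∧ ∀ a : ℝ, 1 ≤ a → c * a ^ (-s) ≤ η.real (Ioc a (K * a)) := by
  have := h.isProbabilityMeasure
  have hs1' : 0 < 1 - s := by linarith
  -- Chosen so that `2δ = δ^s/8`, which is possible because `s < 1`. With `K^s = 16/δ^s` the two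
  -- error terms below cost `δ^s/8 · a^(-s)` each, against a main term of at least `δ^s/2 · a^(-s)`.
  set δ : ℝ := (1 / 16) ^ (1 / (1 - s)) with hδ
  have hδ0 : 0 < δ := by positivity
  have hδ1 : δ ≤ 1 := Real.rpow_le_one (by norm_num) (by norm_num) (by positivity)
  have hδs : 2 * δ = δ ^ s / 8 := by
    have h1 : δ ^ (1 - s) = 1 / 16 := by
      rw [hδ, ← Real.rpow_mul (by norm_num), one_div_mul_cancel hs1'.ne', Real.rpow_one]
    have h2 : δ = δ ^ s * δ ^ (1 - s) := by rw [← Real.rpow_add hδ0]; simp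
    rw [h1] at h2; linarith
  have hδs0 : 0 < δ ^ s := by positivity
  have hδs1 : δ ^ s ≤ 1 := Real.rpow_le_one hδ0.le hδ1 hs0.le
  set K : ℝ := (16 / δ ^ s) ^ (1 / s) with hK
  have hKs : K ^ s = 16 / δ ^ s := by
    rw [hK, ← Real.rpow_mul (by positivity), one_div_mul_cancel hs0.ne', Real.rpow_one]
  have hK1 : 1 ≤ K := Real.one_le_rpow (by rw [le_div_iff₀ hδs0]; linarith) (by positivity)
  have hK0 : 0 < K := by linarith
  refine ⟨δ ^ s / 4, K, by positivity, hK1, fun a ha => ?_⟩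
  have ha0 : 0 < a := by linarith
  have e1 : 0 ≤ δ / a := by positivity
  have e2 : 0 ≤ 1 / a := by positivity
  have e3 : 0 ≤ 1 / (K * a) := by positivity
  -- The three terms on the right cover `τ ≤ a`, `τ > K a` and the block in between. Integrating
  -- turns the exponentials into known Laplace transforms and isolates the mass of the block.
  have hle : ∀ᵐ τ ∂η, 1 - Real.exp (-(δ / a * τ)) ≤ 2 * δ * (1 - Real.exp (-(1 / a * τ)))
      + 2 * (1 - Real.exp (-(1 / (K * a) * τ))) + indicator (Ioc a (K * a)) 1 τ := by
    filter_upwards [h.ae_pos] with τ hτ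
    have p1 : 0 ≤ 1 - Real.exp (-(1 / a * τ)) := by
      have : Real.exp (-(1 / a * τ)) ≤ 1 := by
        rw [Real.exp_le_one_iff]; have := mul_nonneg e2 hτ.le; linarith
      linarith
    have p2 : 0 ≤ 1 - Real.exp (-(1 / (K * a) * τ)) := by
      have : Real.exp (-(1 / (K * a) * τ)) ≤ 1 := by
        rw [Real.exp_le_one_iff]; have := mul_nonneg e3 hτ.le; linarith
      linarith
    have p3 : (0 : ℝ) ≤ indicator (Ioc a (K * a)) 1 τ := indicator_nonneg (by simp) _
    have p4 := Real.exp_pos (-(δ / a * τ))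
    rcases le_or_gt τ a with h1 | h1
    · have := half_mul_le_one_sub_exp (x := 1 / a * τ) (by positivity)
        (by rw [one_div, inv_mul_le_iff₀ ha0]; linarith)
      have h5 := Real.add_one_le_exp (-(δ / a * τ))
      have h6 : δ / a * τ = 2 * δ * (1 / a * τ / 2) := by ring
      have h7 := mul_le_mul_of_nonneg_left this (by positivity : 0 ≤ 2 * δ)
      linarith
    · rcases le_or_gt τ (K * a) with h2 | h2
      · have : indicator (Ioc a (K * a)) (1 : ℝ → ℝ) τ = 1 := indicator_of_mem (mem_Ioc.2 ⟨h1, h2⟩) _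
        rw [this]
        have := mul_nonneg (by positivity : 0 ≤ 2 * δ) p1
        linarith
      · have := half_le_one_sub_exp (x := 1 / (K * a) * τ)
          (by rw [one_div, le_inv_mul_iff₀ (by positivity)]; linarith)
        have := mul_nonneg (by positivity : 0 ≤ 2 * δ) p1
        linarith
  have i1 := (h.integrable_one_sub_exp e2).const_mul (2 * δ)
  have i2 := (h.integrable_one_sub_exp e3).const_mul 2
  have i3 : Integrable (indicator (Ioc a (K * a)) (1 : ℝ → ℝ)) η :=
    (integrable_const (1 : ℝ)).indicator measurableSet_Ioc
  have hmono := integral_mono_ae (h.integrable_one_sub_exp e1) ((i1.add i2).add i3) hle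
  have hsplit : ∫ τ, (2 * δ * (1 - Real.exp (-(1 / a * τ)))
      + 2 * (1 - Real.exp (-(1 / (K * a) * τ))) + indicator (Ioc a (K * a)) 1 τ) ∂η
      = 2 * δ * ∫ τ, (1 - Real.exp (-(1 / a * τ))) ∂η
        + 2 * ∫ τ, (1 - Real.exp (-(1 / (K * a) * τ))) ∂η + η.real (Ioc a (K * a)) := by
    have e4 := integral_add (i1.add i2) i3
    have e5 := integral_add i1 i2
    simp only [Pi.add_apply] at e4
    rw [e4, e5, integral_const_mul, integral_const_mul,
      integral_indicator_one measurableSet_Ioc]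
  have hmono' : ∫ τ, (1 - Real.exp (-(δ / a * τ))) ∂η ≤ 2 * δ * ∫ τ, (1 - Real.exp (-(1 / a * τ))) ∂η
        + 2 * ∫ τ, (1 - Real.exp (-(1 / (K * a) * τ))) ∂η + η.real (Ioc a (K * a)) :=
    hmono.trans hsplit.le
  have f2 := h.integral_one_sub_exp_le e2
  have f3 := h.integral_one_sub_exp_le e3
  rw [h.integral_one_sub_exp e1] at hmono'
  have g1 : (δ / a) ^ s = δ ^ s * a ^ (-s) := by
    rw [Real.div_rpow hδ0.le ha0.le, Real.rpow_neg ha0.le, div_eq_mul_inv]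
  have g2 : (1 / a) ^ s = a ^ (-s) := by
    rw [one_div, Real.inv_rpow ha0.le, Real.rpow_neg ha0.le]
  have g3 : (1 / (K * a)) ^ s = δ ^ s / 16 * a ^ (-s) := by
    rw [one_div, Real.inv_rpow (by positivity), Real.mul_rpow hK0.le ha0.le, hKs,
      Real.rpow_neg ha0.le]
    field_simp
  have ha1 : a ^ (-s) ≤ 1 := Real.rpow_le_one_of_one_le_of_nonpos ha (by linarith)
  have hapos : 0 < a ^ (-s) := by positivity
  have f1 := half_mul_le_one_sub_exp (x := (δ / a) ^ s) (by positivity)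
    (by rw [g1]; exact mul_le_one₀ hδs1 hapos.le ha1)
  rw [g2] at f2; rw [g3] at f3; rw [g1] at f1 hmono'
  have f2' := mul_le_mul_of_nonneg_left f2 (by positivity : 0 ≤ 2 * δ)
  have : 2 * δ * a ^ (-s) = δ ^ s / 8 * a ^ (-s) := by rw [hδs]
  linarith

end IsStableLaw

/-! ### Gaussian estimates -/

/-- The heat kernel at time `τ`. -/
def gauss {n : ℕ} (τ : ℝ) (z : E n) : ℝ :=
  (4 * Real.pi * τ) ^ (-((n : ℝ) / 2)) * Real.exp (-(‖z‖ ^ 2 / (4 * τ)))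

lemma exp_sub_one_sub_le (x : ℝ) : Real.exp x - 1 - x ≤ x ^ 2 * max 1 (Real.exp x) := by
  have h1 := Real.add_one_le_exp (-x)
  have h2 := Real.add_one_le_exp x
  have h3 : Real.exp (-x) * Real.exp x = 1 := by rw [← Real.exp_add]; simp
  have h4 : Real.exp x - 1 ≤ x * Real.exp x := by nlinarith [Real.exp_pos x]
  rcases le_total 0 x with hx | hx
  · have := mul_le_mul_of_nonneg_left (le_max_right 1 (Real.exp x)) (sq_nonneg x)
    nlinarith
  · have := mul_le_mul_of_nonneg_left (le_max_left 1 (Real.exp x)) (sq_nonneg x)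
    nlinarith

/-- The common lower bound `m` for both exponents keeps Gaussian decay in the error term. -/
lemma abs_exp_neg_taylor_le {A B m : ℝ} (hA : m ≤ A) (hB : m ≤ B) :
    |Real.exp (-B) - Real.exp (-A) + (B - A) * Real.exp (-A)| ≤ (B - A) ^ 2 * Real.exp (-m) := by
  have key : Real.exp (-B) - Real.exp (-A) + (B - A) * Real.exp (-A)
      = Real.exp (-A) * (Real.exp (A - B) - 1 - (A - B)) := by
    have : Real.exp (-B) = Real.exp (-A) * Real.exp (A - B) := by
      rw [← Real.exp_add]; ring_nf
    rw [this]; ring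
  have h0 : 0 ≤ Real.exp (A - B) - 1 - (A - B) := by linarith [Real.add_one_le_exp (A - B)]
  rw [key, abs_of_nonneg (mul_nonneg (Real.exp_pos _).le h0)]
  calc _ ≤ Real.exp (-A) * ((A - B) ^ 2 * max 1 (Real.exp (A - B))) := by
        gcongr; exact exp_sub_one_sub_le _
    _ = (B - A) ^ 2 * max (Real.exp (-A)) (Real.exp (-B)) := by
        have : max (Real.exp (-A)) (Real.exp (-B))
            = Real.exp (-A) * max 1 (Real.exp (A - B)) := by
          rw [mul_max_of_nonneg _ _ (Real.exp_pos _).le, ← Real.exp_add]; ring_nf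
        rw [this]; ring
    _ ≤ _ := by
        gcongr
        exact max_le (Real.exp_le_exp.2 (by linarith)) (Real.exp_le_exp.2 (by linarith))

lemma four_pi_mul_rpow_le {n : ℕ} {τ : ℝ} (hτ : 0 < τ) :
    (4 * Real.pi * τ) ^ (-((n : ℝ) / 2)) ≤ τ ^ (-((n : ℝ) / 2)) := by
  refine Real.rpow_le_rpow_of_nonpos hτ ?_ (by have : (0 : ℝ) ≤ n := n.cast_nonneg; linarith)
  nlinarith [Real.pi_gt_three]

lemma gauss_nonneg {n : ℕ} {τ : ℝ} (hτ : 0 < τ) (z : E n) : 0 ≤ gauss τ z := by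
  unfold gauss; positivity

lemma gauss_le {n : ℕ} {τ : ℝ} (hτ : 0 < τ) (z : E n) : gauss τ z ≤ τ ^ (-((n : ℝ) / 2)) := by
  unfold gauss
  have : Real.exp (-(‖z‖ ^ 2 / (4 * τ))) ≤ 1 := by
    rw [Real.exp_le_one_iff]
    have : 0 ≤ ‖z‖ ^ 2 / (4 * τ) := by positivity
    linarith
  calc _ ≤ τ ^ (-((n : ℝ) / 2)) * 1 :=
        mul_le_mul (four_pi_mul_rpow_le hτ) this (Real.exp_pos _).le (by positivity)
    _ = _ := mul_one _

/-- The increment of the exponent is exactly `(‖h‖² - 2⟨z,h⟩)/(4τ)`. Its inner product part gives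
the linear term; the rest is the quadratic error of the exponential plus a term in `‖h‖²/τ`. The
parameter `q` is free: `0` serves for bounded `z`, `‖z‖/2` for large `z`. -/
lemma gauss_taylor {n : ℕ} {τ : ℝ} (hτ : 0 < τ) (z h : E n) (hh : ‖h‖ ≤ 1) {q : ℝ} (hq0 : 0 ≤ q)
    (hq1 : q ≤ ‖z‖) (hq2 : q ≤ ‖z - h‖) :
    |gauss τ (z - h) - gauss τ z - gauss τ z / (2 * τ) * inner ℝ z h|
      ≤ ‖h‖ ^ 2 * (τ ^ (-((n : ℝ) / 2)) * ((1 + 2 * ‖z‖) ^ 2 / τ ^ 2 + 1 / τ)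
        * Real.exp (-(q ^ 2 / (4 * τ)))) := by
  set g := (4 * Real.pi * τ) ^ (-((n : ℝ) / 2)) with hg
  set A := ‖z‖ ^ 2 / (4 * τ) with hA
  set B := ‖z - h‖ ^ 2 / (4 * τ) with hB
  set m := q ^ 2 / (4 * τ) with hm
  have hmA : m ≤ A := by rw [hm, hA]; gcongr
  have hmB : m ≤ B := by rw [hm, hB]; gcongr
  have hBA : B - A = (‖h‖ ^ 2 - 2 * inner ℝ z h) / (4 * τ) := by
    rw [hA, hB, norm_sub_sq_real]; ring
  have hg0 : 0 ≤ g := by positivity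
  have heq : gauss τ (z - h) - gauss τ z - gauss τ z / (2 * τ) * inner ℝ z h
      = g * ((Real.exp (-B) - Real.exp (-A) + (B - A) * Real.exp (-A))
        - ‖h‖ ^ 2 / (4 * τ) * Real.exp (-A)) := by
    rw [hBA]
    simp only [gauss, ← hg, ← hA, ← hB]
    field_simp
    ring
  have hsq : (B - A) ^ 2 ≤ ‖h‖ ^ 2 * ((1 + 2 * ‖z‖) ^ 2 / τ ^ 2) := by
    have h1 : |‖h‖ ^ 2 - 2 * inner ℝ z h| ≤ ‖h‖ * (1 + 2 * ‖z‖) := by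
      have := abs_real_inner_le_norm z h
      rw [abs_le] at this ⊢
      constructor <;> nlinarith [norm_nonneg h, norm_nonneg z]
    have h2 : (‖h‖ ^ 2 - 2 * inner ℝ z h) ^ 2 ≤ (‖h‖ * (1 + 2 * ‖z‖)) ^ 2 := sq_le_sq'
      (abs_le.1 h1).1 (abs_le.1 h1).2
    rw [hBA, div_pow, ← mul_div_assoc, ← mul_pow]
    gcongr
    linarith
  rw [heq, abs_mul, abs_of_nonneg hg0]
  have hexp : Real.exp (-A) ≤ Real.exp (-m) := Real.exp_le_exp.2 (by linarith)
  calc _ ≤ g * ((B - A) ^ 2 * Real.exp (-m) + ‖h‖ ^ 2 / (4 * τ) * Real.exp (-m)) := by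
        gcongr
        refine (abs_sub _ _).trans (add_le_add (abs_exp_neg_taylor_le hmA hmB) ?_)
        rw [abs_of_nonneg (by positivity)]
        gcongr
    _ ≤ τ ^ (-((n : ℝ) / 2)) * (‖h‖ ^ 2 * ((1 + 2 * ‖z‖) ^ 2 / τ ^ 2) * Real.exp (-m)
          + ‖h‖ ^ 2 / τ * Real.exp (-m)) := by
        gcongr
        · exact four_pi_mul_rpow_le hτ
        · linarith
    _ = _ := by ring

/-- Applied with `w = r²/τ`, this trades Gaussian errors for `1 - exp(-τ/r²)`, whose `η`-integral is
controlled by the Laplace transform. The right side is bounded below for `w ≤ 1` and is of order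
`1/w` for `w ≥ 1`, where the exponential beats any power. -/
lemma exists_rpow_mul_exp_neg_le {q b : ℝ} (hq : 0 ≤ q) (hb : 0 < b) :
    ∃ C : ℝ, 0 < C ∧ ∀ w : ℝ, 0 < w →
      w ^ q * Real.exp (-(b * w)) ≤ C * (1 - Real.exp (-(1 / w))) := by
  obtain ⟨m, hm⟩ := exists_nat_ge (q + 1)
  set D : ℝ := m.factorial / b ^ m with hD
  have hD0 : 0 < D := by positivity
  refine ⟨2 * max 1 D, by positivity, fun w hw => ?_⟩
  rcases le_total w 1 with h1 | h1
  · have h2 := IsStableLaw.half_le_one_sub_exp (x := 1 / w) (by rw [le_div_iff₀ hw]; linarith)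
    have h3 : w ^ q ≤ 1 := Real.rpow_le_one hw.le h1 hq
    have h4 : Real.exp (-(b * w)) ≤ 1 := by
      rw [Real.exp_le_one_iff]; have := mul_pos hb hw; linarith
    have h5 := mul_le_one₀ h3 (Real.exp_pos _).le h4
    have h6 : 1 ≤ max 1 D := le_max_left _ _
    nlinarith
  · have h2 := IsStableLaw.half_mul_le_one_sub_exp (x := 1 / w) (by positivity)
      (by rw [div_le_iff₀ hw]; linarith)
    have h3 : w ^ q * w ≤ w ^ m := by
      rw [← Real.rpow_add_one hw.ne', ← Real.rpow_natCast]
      exact Real.rpow_le_rpow_of_exponent_le h1 hm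
    have h4 := Real.pow_div_factorial_le_exp (b * w) (by positivity) m
    have h5 : w ^ m * Real.exp (-(b * w)) ≤ D := by
      rw [Real.exp_neg, ← div_eq_mul_inv, div_le_iff₀ (Real.exp_pos _), hD, div_mul_eq_mul_div,
        le_div_iff₀ (by positivity)]
      rw [div_le_iff₀ (by positivity), mul_pow] at h4
      linarith
    have h6 : w ^ q * Real.exp (-(b * w)) ≤ D * (1 / w) := by
      rw [mul_one_div, le_div_iff₀ hw]
      calc _ = w ^ q * w * Real.exp (-(b * w)) := by ring
        _ ≤ w ^ m * Real.exp (-(b * w)) := by gcongr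
        _ ≤ D := h5
    have h7 : D ≤ max 1 D := le_max_right _ _
    have h8 : 0 < 1 / w := by positivity
    nlinarith

/-! ### The Gaussian mixture of the stable law -/

namespace IsStableLaw

variable {s : ℝ} {η : Measure ℝ} {n : ℕ}

lemma measurable_gauss (z : E n) : Measurable fun τ : ℝ => gauss τ z := by
  unfold gauss; fun_prop

lemma integrable_gauss (h : IsStableLaw s η) (hs0 : 0 < s) (z : E n) :
    Integrable (fun τ => gauss τ z) η := by
  refine (h.integrable_rpow_neg hs0 (p := (n : ℝ) / 2) (by positivity)).mono'
    (measurable_gauss z).aestronglyMeasurable ?_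
  filter_upwards [h.ae_pos] with τ hτ
  rw [Real.norm_of_nonneg (gauss_nonneg hτ z)]
  exact gauss_le hτ z

lemma integrable_gauss_div (h : IsStableLaw s η) (hs0 : 0 < s) (z : E n) :
    Integrable (fun τ => gauss τ z / (2 * τ)) η := by
  refine (h.integrable_rpow_neg hs0 (p := (n : ℝ) / 2 + 1) (by positivity)).mono'
    ((measurable_gauss z).div (by fun_prop)).aestronglyMeasurable ?_
  filter_upwards [h.ae_pos] with τ hτ
  have h0 := gauss_nonneg hτ z
  rw [Real.norm_of_nonneg (by positivity)]
  have : τ ^ (-((n : ℝ) / 2 + 1)) = τ ^ (-((n : ℝ) / 2)) / τ := by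
    rw [neg_add, ← sub_eq_add_neg, Real.rpow_sub_one hτ.ne']
  rw [this]
  have := gauss_le hτ z
  gcongr
  linarith

/-- Keep only `τ` in `(ρ², Kρ²]`: there the Gaussian is at least a constant times `ρ^(-n)`, and the
block has mass at least `c ρ^(-2s)`. -/
lemma exists_le_integral_gauss (h : IsStableLaw s η) (hs0 : 0 < s) (hs1 : s < 1) :
    ∃ c : ℝ, 0 < c ∧ ∀ (z : E n) (ρ : ℝ), 1 ≤ ρ → ‖z‖ ≤ ρ →
      c * ρ ^ (-((n : ℝ) + 2 * s)) ≤ ∫ τ, gauss τ z ∂η := by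
  have := h.isProbabilityMeasure
  obtain ⟨c, K, hc, hK, hcK⟩ := h.exists_le_measure_Ioc hs0 hs1
  have hK0 : 0 < K := by linarith
  refine ⟨(4 * Real.pi * K) ^ (-((n : ℝ) / 2)) * Real.exp (-(1 / 4)) * c, by positivity,
    fun z ρ hρ hz => ?_⟩
  have hρ0 : 0 < ρ := by linarith
  set b : ℝ := (4 * Real.pi * (K * ρ ^ 2)) ^ (-((n : ℝ) / 2)) * Real.exp (-(1 / 4)) with hb
  have hle : ∀ᵐ τ ∂η, indicator (Ioc (ρ ^ 2) (K * ρ ^ 2)) (fun _ => b) τ ≤ gauss τ z := by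
    filter_upwards [h.ae_pos] with τ hτ
    by_cases hτ' : τ ∈ Ioc (ρ ^ 2) (K * ρ ^ 2)
    swap
    · rw [indicator_of_notMem hτ']; exact gauss_nonneg hτ z
    rw [indicator_of_mem hτ']
    unfold gauss
    refine mul_le_mul ?_ ?_ (Real.exp_pos _).le (by positivity)
    · refine Real.rpow_le_rpow_of_nonpos (by positivity) ?_
        (by have : (0 : ℝ) ≤ n := n.cast_nonneg; linarith)
      have := hτ'.2
      gcongr
    · refine Real.exp_le_exp.2 (neg_le_neg ?_)
      rw [div_le_div_iff₀ (by positivity) (by norm_num)]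
      have h1 : ‖z‖ ^ 2 ≤ ρ ^ 2 := by gcongr
      have := hτ'.1
      linarith
  have hmono := integral_mono_ae ((integrable_const b).indicator measurableSet_Ioc)
    (h.integrable_gauss hs0 z) hle
  rw [integral_indicator_const _ measurableSet_Ioc, smul_eq_mul] at hmono
  refine le_trans ?_ hmono
  have h1 := hcK (ρ ^ 2) (by nlinarith)
  have hb0 : 0 ≤ b := by positivity
  refine le_trans (le_of_eq ?_) (mul_le_mul_of_nonneg_right h1 hb0)
  have e1 : (ρ ^ 2) ^ (-s) = ρ ^ (-(2 * s)) := by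
    rw [← Real.rpow_natCast, ← Real.rpow_mul hρ0.le]; norm_num
  have e2 : (ρ ^ 2) ^ (-((n : ℝ) / 2)) = ρ ^ (-(n : ℝ)) := by
    rw [← Real.rpow_natCast, ← Real.rpow_mul hρ0.le]; congr 1; push_cast; ring
  rw [hb, ← mul_assoc (4 * Real.pi) K,
    Real.mul_rpow (z := -((n : ℝ) / 2)) (by positivity : 0 ≤ 4 * Real.pi * K) (by positivity),
    Real.mul_rpow (by positivity) hK0.le, e1, e2,
    neg_add, Real.rpow_add hρ0]
  ring

/-- Integral bound, uniform for `‖z‖ ≤ 2` and decaying for `‖z‖ ≥ 2`, of the Taylor remainder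
majorant of the Gaussians. -/
lemma exists_integral_majorant_le (h : IsStableLaw s η) (hs0 : 0 < s) (hs1 : s < 1) :
    ∃ C : ℝ, 0 < C ∧ ∀ z : E n, ∃ m : ℝ → ℝ, Integrable m η ∧
      ∫ τ, m τ ∂η ≤ C * ∫ τ, gauss τ z ∂η ∧
      ∀ (k : E n), ‖k‖ ≤ 1 → ∀ τ : ℝ, 0 < τ →
        |gauss τ (z - k) - gauss τ z - gauss τ z / (2 * τ) * inner ℝ z k| ≤ ‖k‖ ^ 2 * m τ := by
  obtain ⟨c, hc, hlow⟩ := h.exists_le_integral_gauss (n := n) hs0 hs1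
  have I1 := h.integrable_rpow_neg hs0 (p := (n : ℝ) / 2 + 1) (by positivity)
  have I2 := h.integrable_rpow_neg hs0 (p := (n : ℝ) / 2 + 2) (by positivity)
  obtain ⟨C1, hC1, hb1⟩ := exists_rpow_mul_exp_neg_le (q := (n : ℝ) / 2 + 1) (b := 1 / 16)
    (by positivity) (by norm_num)
  obtain ⟨C2, hC2, hb2⟩ := exists_rpow_mul_exp_neg_le (q := (n : ℝ) / 2 + 2) (b := 1 / 16)
    (by positivity) (by norm_num)
  set J : ℝ := ∫ τ, (25 * τ ^ (-((n : ℝ) / 2 + 2)) + τ ^ (-((n : ℝ) / 2 + 1))) ∂η with hJ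
  have hJ0 : 0 ≤ J := by
    refine integral_nonneg_of_ae ?_
    filter_upwards [h.ae_pos] with τ hτ
    simp only [Pi.zero_apply]; positivity
  have r1 : ∀ τ : ℝ, 0 < τ → τ ^ (-((n : ℝ) / 2 + 1)) = τ ^ (-((n : ℝ) / 2)) * (1 / τ) := by
    intro τ hτ
    rw [neg_add, ← sub_eq_add_neg, Real.rpow_sub_one hτ.ne', mul_one_div]
  have r2 : ∀ τ : ℝ, 0 < τ → τ ^ (-((n : ℝ) / 2 + 2)) = τ ^ (-((n : ℝ) / 2)) * (1 / τ ^ 2) := by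
    intro τ hτ
    rw [neg_add, Real.rpow_add hτ, Real.rpow_neg hτ.le 2, Real.rpow_two, one_div]
  refine ⟨J / (c * 2 ^ (-((n : ℝ) + 2 * s))) + (9 * C2 + C1) / c, by positivity, fun z => ?_⟩
  have hF0 : 0 ≤ ∫ τ, gauss τ z ∂η := by
    refine integral_nonneg_of_ae ?_
    filter_upwards [h.ae_pos] with τ hτ using gauss_nonneg hτ z
  rcases le_total ‖z‖ 2 with hz | hz
  -- Bounded `z`: negative moments of `η` suffice, since the mixture is bounded below. The factor
  -- `25` is `(1 + 2·2)²`.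
  · refine ⟨_, (I2.const_mul 25).add I1, ?_, fun k hk τ hτ => ?_⟩
    · have h1 := hlow z 2 one_le_two hz
      have h2 : (0 : ℝ) < c * 2 ^ (-((n : ℝ) + 2 * s)) := by positivity
      have h3 : J ≤ J / (c * 2 ^ (-((n : ℝ) + 2 * s))) * ∫ τ, gauss τ z ∂η := by
        rw [div_mul_eq_mul_div, le_div_iff₀ h2]
        gcongr
      refine h3.trans ?_
      have : 0 ≤ (9 * C2 + C1) / c := by positivity
      gcongr
      linarith
    · refine (gauss_taylor hτ z k hk le_rfl (norm_nonneg _) (norm_nonneg _)).trans ?_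
      simp only [Pi.add_apply]
      rw [r1 τ hτ, r2 τ hτ]
      simp only [ne_eq, OfNat.ofNat_ne_zero, not_false_eq_true, zero_pow, zero_div, neg_zero,
        Real.exp_zero, mul_one]
      have : (1 + 2 * ‖z‖) ^ 2 ≤ 25 := by nlinarith [norm_nonneg z]
      calc _ ≤ ‖k‖ ^ 2 * (τ ^ (-((n : ℝ) / 2)) * (25 / τ ^ 2 + 1 / τ)) := by gcongr
        _ = _ := by ring
  · set r := ‖z‖ with hr
    have hr0 : 0 < r := by linarith
    have e1 : 0 ≤ 1 / r ^ 2 := by positivity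
    refine ⟨_, (h.integrable_one_sub_exp e1).const_mul ((9 * C2 + C1) * r ^ (-((n : ℝ) + 2))),
      ?_, fun k hk τ hτ => ?_⟩
    · rw [integral_const_mul]
      have h1 := hlow z r (by linarith) le_rfl
      have h2 := h.integral_one_sub_exp_le e1
      have h3 : (1 / r ^ 2) ^ s = r ^ (-(2 * s)) := by
        rw [one_div, Real.inv_rpow (by positivity), ← Real.rpow_natCast, ← Real.rpow_mul hr0.le,
          ← Real.rpow_neg hr0.le]
        norm_num
      -- The errors decay like `r^(-(n+2+2s))`, so a factor `r^(-2)` is given away here.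
      have h4 : r ^ (-((n : ℝ) + 2)) * r ^ (-(2 * s)) ≤ r ^ (-((n : ℝ) + 2 * s)) := by
        rw [← Real.rpow_add hr0]
        exact Real.rpow_le_rpow_of_exponent_le (by linarith) (by linarith)
      rw [h3] at h2
      calc _ ≤ (9 * C2 + C1) * r ^ (-((n : ℝ) + 2)) * r ^ (-(2 * s)) := by gcongr
        _ ≤ (9 * C2 + C1) * r ^ (-((n : ℝ) + 2 * s)) := by
          rw [mul_assoc]; gcongr
        _ = (9 * C2 + C1) / c * (c * r ^ (-((n : ℝ) + 2 * s))) := by field_simp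
        _ ≤ (9 * C2 + C1) / c * ∫ τ, gauss τ z ∂η := by gcongr
        _ ≤ _ := by
          gcongr
          have : 0 ≤ J / (c * 2 ^ (-((n : ℝ) + 2 * s))) := by positivity
          linarith
    -- As `‖k‖ ≤ 1 ≤ r/2`, the choice `q = r/2` is admissible; it produces the rate `1/16` in the
    -- exponential.
    · have hq2 : r / 2 ≤ ‖z - k‖ := by
        have := norm_sub_norm_le z k
        linarith
      refine (gauss_taylor hτ z k hk (by positivity) (by linarith) hq2).trans ?_
      have hw : 0 < r ^ 2 / τ := by positivity
      have b1 := hb1 _ hw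
      have b2 := hb2 _ hw
      have x1 : (r ^ 2 / τ) ^ ((n : ℝ) / 2 + 1) * r ^ (-((n : ℝ) + 2))
          = τ ^ (-((n : ℝ) / 2)) * (1 / τ) := by
        rw [Real.div_rpow (by positivity) hτ.le, ← Real.rpow_natCast r 2, ← Real.rpow_mul hr0.le,
          div_mul_eq_mul_div, ← Real.rpow_add hr0, ← r1 τ hτ, Real.rpow_neg hτ.le, ← one_div]
        congr 1
        convert Real.rpow_zero r using 2
        push_cast; ring
      have x2 : (r ^ 2 / τ) ^ ((n : ℝ) / 2 + 2) * r ^ (-((n : ℝ) + 2))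
          = τ ^ (-((n : ℝ) / 2)) * (r ^ 2 / τ ^ 2) := by
        have : τ ^ (-((n : ℝ) / 2)) * (r ^ 2 / τ ^ 2)
            = r ^ 2 * (τ ^ (-((n : ℝ) / 2)) * (1 / τ ^ 2)) := by ring
        rw [this, ← r2 τ hτ, Real.div_rpow (by positivity) hτ.le, ← Real.rpow_natCast r 2, ← Real.rpow_mul hr0.le,
          div_mul_eq_mul_div, ← Real.rpow_add hr0, Real.rpow_neg hτ.le, div_eq_mul_inv]
        congr 2
        push_cast; ring
      have hsq : (1 + 2 * r) ^ 2 ≤ 9 * r ^ 2 := by nlinarith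
      have hexp : Real.exp (-((r / 2) ^ 2 / (4 * τ))) = Real.exp (-(1 / 16 * (r ^ 2 / τ))) := by
        congr 1; ring
      have hinv : 1 / (r ^ 2 / τ) = 1 / r ^ 2 * τ := by field_simp
      rw [hinv] at b1 b2
      rw [hexp]
      refine mul_le_mul_of_nonneg_left ?_ (by positivity)
      calc _ ≤ τ ^ (-((n : ℝ) / 2)) * (9 * r ^ 2 / τ ^ 2 + 1 / τ)
            * Real.exp (-(1 / 16 * (r ^ 2 / τ))) := by gcongr
        _ = r ^ (-((n : ℝ) + 2)) * (9 * ((r ^ 2 / τ) ^ ((n : ℝ) / 2 + 2)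
              * Real.exp (-(1 / 16 * (r ^ 2 / τ))))
            + (r ^ 2 / τ) ^ ((n : ℝ) / 2 + 1) * Real.exp (-(1 / 16 * (r ^ 2 / τ)))) := by
          linear_combination (-9 * Real.exp (-(1 / 16 * (r ^ 2 / τ)))) * x2
            - Real.exp (-(1 / 16 * (r ^ 2 / τ))) * x1
        _ ≤ r ^ (-((n : ℝ) + 2)) * (9 * (C2 * (1 - Real.exp (-(1 / r ^ 2 * τ))))
            + C1 * (1 - Real.exp (-(1 / r ^ 2 * τ)))) := by gcongr
        _ = _ := by ring

/-- Second order Taylor estimate for the Gaussian mixture, relative to the mixture itself. -/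
lemma exists_integral_gauss_taylor (h : IsStableLaw s η) (hs0 : 0 < s) (hs1 : s < 1) :
    ∃ C : ℝ, 0 < C ∧ ∀ z k : E n, ‖k‖ ≤ 1 →
      |∫ τ, gauss τ (z - k) ∂η - ∫ τ, gauss τ z ∂η
        - (∫ τ, gauss τ z / (2 * τ) ∂η) * inner ℝ z k| ≤ C * ‖k‖ ^ 2 * ∫ τ, gauss τ z ∂η := by
  obtain ⟨C, hC, hmaj⟩ := h.exists_integral_majorant_le (n := n) hs0 hs1
  refine ⟨C, hC, fun z k hk => ?_⟩
  obtain ⟨m, hm, hmle, hb⟩ := hmaj z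
  have hsub := (h.integrable_gauss hs0 (z - k)).sub (h.integrable_gauss hs0 z)
  have heq : ∫ τ, gauss τ (z - k) ∂η - ∫ τ, gauss τ z ∂η
        - (∫ τ, gauss τ z / (2 * τ) ∂η) * inner ℝ z k
      = ∫ τ, (gauss τ (z - k) - gauss τ z - gauss τ z / (2 * τ) * inner ℝ z k) ∂η := by
    rw [← integral_mul_const, ← integral_sub (h.integrable_gauss hs0 (z - k))
      (h.integrable_gauss hs0 z)]
    exact (integral_sub hsub ((h.integrable_gauss_div hs0 z).mul_const _)).symm
  rw [heq, ← Real.norm_eq_abs]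
  have hle : ∀ᵐ τ ∂η, ‖gauss τ (z - k) - gauss τ z - gauss τ z / (2 * τ) * inner ℝ z k‖
      ≤ ‖k‖ ^ 2 * m τ := by
    filter_upwards [h.ae_pos] with τ hτ
    rw [Real.norm_eq_abs]
    exact hb k hk τ hτ
  refine (norm_integral_le_of_norm_le (hm.const_mul _) hle).trans ?_
  rw [integral_const_mul]
  calc _ ≤ ‖k‖ ^ 2 * (C * ∫ τ, gauss τ z ∂η) := by gcongr
    _ = _ := by ring

end IsStableLaw

/-! ### The fractional heat kernel -/

/-- The Fourier symbol `(2π|ξ|)^(2s)` of the fractional Laplacian. -/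
def symbol {n : ℕ} (s : ℝ) (ξ : E n) : ℝ := (2 * Real.pi * ‖ξ‖) ^ (2 * s)

lemma symbol_nonneg {n : ℕ} (s : ℝ) (ξ : E n) : 0 ≤ symbol s ξ := by
  unfold symbol; positivity

lemma continuous_symbol {n : ℕ} {s : ℝ} (hs0 : 0 < s) : Continuous (symbol s : E n → ℝ) := by
  unfold symbol
  exact Continuous.rpow_const (by fun_prop) fun _ => Or.inr (by positivity)

lemma symbol_eq_sq_rpow {n : ℕ} (s : ℝ) (ξ : E n) :
    symbol s ξ = ((2 * Real.pi * ‖ξ‖) ^ 2) ^ s := by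
  rw [symbol, Real.rpow_mul (by positivity), Real.rpow_two]

lemma symbol_smul {n : ℕ} (s : ℝ) {a : ℝ} (ha : 0 ≤ a) (ξ : E n) :
    symbol s (a • ξ) = a ^ (2 * s) * symbol s ξ := by
  rw [symbol, symbol, norm_smul, Real.norm_of_nonneg ha, ← Real.mul_rpow ha (by positivity)]
  ring_nf

lemma integral_exp_neg_sq_mul {n : ℕ} {τ : ℝ} (hτ : 0 < τ) :
    ∫ ξ : E n, Real.exp (-((2 * Real.pi * ‖ξ‖) ^ 2 * τ)) = (4 * Real.pi * τ) ^ (-((n : ℝ) / 2)) := by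
  have h := GaussianFourier.integral_rexp_neg_mul_sq_norm (V := E n)
    (b := (2 * Real.pi) ^ 2 * τ) (by positivity)
  rw [finrank_euclideanSpace_fin] at h
  have e : Real.pi / ((2 * Real.pi) ^ 2 * τ) = (4 * Real.pi * τ)⁻¹ := by
    field_simp; norm_num
  rw [e, Real.inv_rpow (by positivity), ← Real.rpow_neg (by positivity)] at h
  rw [← h]
  congr 1; ext ξ; ring_nf

lemma integrable_exp_neg_sq_mul {n : ℕ} {τ : ℝ} (hτ : 0 < τ) :
    Integrable fun ξ : E n => Real.exp (-((2 * Real.pi * ‖ξ‖) ^ 2 * τ)) := by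
  by_contra hcon
  have h := integral_undef hcon
  rw [integral_exp_neg_sq_mul hτ] at h
  have : 0 < (4 * Real.pi * τ) ^ (-((n : ℝ) / 2)) := by positivity
  exact this.ne' h

lemma fourierInv_exp_neg_sq_mul {n : ℕ} {τ : ℝ} (hτ : 0 < τ) (x : E n) :
    𝓕⁻ (fun ξ : E n => ((Real.exp (-((2 * Real.pi * ‖ξ‖) ^ 2 * τ)) : ℝ) : ℂ)) x = gauss τ x := by
  have h := fourier_gaussian_innerProductSpace (V := E n)
    (b := (((2 * Real.pi) ^ 2 * τ : ℝ) : ℂ)) (by rw [Complex.ofReal_re]; positivity) (-x)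
  rw [finrank_euclideanSpace_fin] at h
  have e : (Real.pi : ℂ) / (((2 * Real.pi) ^ 2 * τ : ℝ) : ℂ) = (((4 * Real.pi * τ)⁻¹ : ℝ) : ℂ) := by
    rw [← Complex.ofReal_div]; congr 1; field_simp; norm_num
  have e2 : (((4 * Real.pi * τ)⁻¹ : ℝ) : ℂ) ^ ((n : ℂ) / 2)
      = (((4 * Real.pi * τ) ^ (-((n : ℝ) / 2)) : ℝ) : ℂ) := by
    rw [Real.rpow_neg (by positivity), ← Real.inv_rpow (by positivity),
      Complex.ofReal_cpow (by positivity)]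
    simp
  rw [e, e2, norm_neg] at h
  rw [Real.fourierInv_eq_fourier_neg]
  convert h using 2
  · ext ξ; push_cast; ring_nf
  · unfold gauss
    rw [Complex.ofReal_mul, Complex.ofReal_exp]
    congr 2
    push_cast
    field_simp
    norm_num

namespace IsStableLaw

variable {s : ℝ} {η : Measure ℝ} {n : ℕ}

lemma integrable_prod_exp (h : IsStableLaw s η) (hs0 : 0 < s) :
    Integrable (fun q : ℝ × E n => Real.exp (-((2 * Real.pi * ‖q.2‖) ^ 2 * q.1)))
      (η.prod volume) := by
  have := h.isProbabilityMeasure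
  rw [integrable_prod_iff (by fun_prop)]
  constructor
  · filter_upwards [h.ae_pos] with τ hτ using integrable_exp_neg_sq_mul hτ
  · refine (h.integrable_gauss hs0 (0 : E n)).congr ?_
    filter_upwards [h.ae_pos] with τ hτ
    simp only [Real.norm_of_nonneg (Real.exp_pos _).le]
    rw [integral_exp_neg_sq_mul hτ]
    simp [gauss]

lemma exp_neg_symbol (h : IsStableLaw s η) (ξ : E n) :
    Real.exp (-symbol s ξ) = ∫ τ, Real.exp (-((2 * Real.pi * ‖ξ‖) ^ 2 * τ)) ∂η := by
  rw [symbol_eq_sq_rpow, h.laplace _ (by positivity)]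

lemma integrable_exp_neg_symbol_one (h : IsStableLaw s η) (hs0 : 0 < s) :
    Integrable fun ξ : E n => Real.exp (-symbol s ξ) := by
  have := h.isProbabilityMeasure
  simp_rw [h.exp_neg_symbol]
  exact (h.integrable_prod_exp hs0).integral_prod_right

/-- Subordination: insert the Laplace representation of the symbol's exponential, exchange the
integrals, and invert each Gaussian. -/
lemma kernel_one (h : IsStableLaw s η) (hs0 : 0 < s) (x : E n) :
    kernel s 1 x = ∫ τ, gauss τ x ∂η := by
  have := h.isProbabilityMeasure
  have h1 : 𝓕⁻ (fun ξ : E n => ((Real.exp (-(1 * (2 * Real.pi * ‖ξ‖) ^ (2 * s))) : ℝ) : ℂ)) x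
      = ∫ τ, (gauss τ x : ℂ) ∂η := by
    have h2 : ∀ ξ : E n, ((Real.exp (-(1 * (2 * Real.pi * ‖ξ‖) ^ (2 * s))) : ℝ) : ℂ)
        = ∫ τ, ((Real.exp (-((2 * Real.pi * ‖ξ‖) ^ 2 * τ)) : ℝ) : ℂ) ∂η := by
      intro ξ
      rw [integral_complex_ofReal, ← h.exp_neg_symbol, one_mul, symbol]
    simp_rw [h2]
    rw [Real.fourierInv_eq']
    simp_rw [← integral_smul]
    rw [integral_integral_swap]
    · refine integral_congr_ae ?_
      filter_upwards [h.ae_pos] with τ hτ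
      rw [← fourierInv_exp_neg_sq_mul hτ, Real.fourierInv_eq']
    · have h3 := ((h.integrable_prod_exp (n := n) hs0).ofReal (𝕜 := ℂ)).swap
      refine h3.mono ?_ (.of_forall fun q => ?_)
      · refine Continuous.aestronglyMeasurable ?_
        simp only [Function.uncurry_def]
        fun_prop
      · simp only [Function.uncurry_def, norm_smul, Complex.norm_exp_ofReal_mul_I, one_mul]
        simp
  unfold kernel
  rw [h1, integral_complex_ofReal, Complex.ofReal_re]

end IsStableLaw

/-! ### Scaling, positivity and Taylor expansion of the kernel. -/

lemma exists_isStableLaw {s : ℝ} (hs0 : 0 < s) (hs1 : s < 1) : ∃ η, IsStableLaw s η := by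
  obtain ⟨η, h1, h2, h3⟩ := exists_stable_law hs0 hs1
  exact ⟨η, h1, h2, h3⟩

lemma rpow_inv_two_mul_rpow {s t : ℝ} (hs0 : 0 < s) (ht : 0 < t) :
    (t ^ (1 / (2 * s))) ^ (2 * s) = t := by
  rw [← Real.rpow_mul ht.le, one_div_mul_cancel (by positivity), Real.rpow_one]

lemma integrable_exp_neg_symbol {n : ℕ} {s : ℝ} (hs0 : 0 < s) (hs1 : s < 1) {t : ℝ} (ht : 0 < t) :
    Integrable fun ξ : E n => Real.exp (-(t * symbol s ξ)) := by
  obtain ⟨η, h⟩ := exists_isStableLaw hs0 hs1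
  have hr : 0 < t ^ (1 / (2 * s)) := by positivity
  have := (h.integrable_exp_neg_symbol_one (n := n) hs0).comp_smul hr.ne'
  simpa only [symbol_smul s hr.le, rpow_inv_two_mul_rpow hs0 ht] using this

lemma kernel_eq_scale {n : ℕ} {s : ℝ} (hs0 : 0 < s) {t : ℝ} (ht : 0 < t) (x : E n) :
    kernel s t x = ((t ^ (1 / (2 * s))) ^ n)⁻¹ * kernel s 1 ((t ^ (1 / (2 * s)))⁻¹ • x) := by
  set r := t ^ (1 / (2 * s)) with hr
  have hr0 : 0 < r := by positivity
  have h1 := Measure.integral_comp_smul (volume : Measure (E n))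
    (fun ξ : E n => Complex.exp (((2 * Real.pi * inner ℝ ξ (r⁻¹ • x) : ℝ) : ℂ) * Complex.I) •
      ((Real.exp (-(1 * symbol s ξ)) : ℝ) : ℂ)) r
  have h2 : ∀ ξ : E n, inner ℝ (r • ξ) (r⁻¹ • x) = inner ℝ ξ x := by
    intro ξ
    rw [real_inner_smul_left, real_inner_smul_right, ← mul_assoc, mul_inv_cancel₀ hr0.ne', one_mul]
  simp only [h2, symbol_smul s hr0.le, one_mul] at h1
  rw [hr, rpow_inv_two_mul_rpow hs0 ht, ← hr, finrank_euclideanSpace_fin,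
    abs_of_pos (by positivity)] at h1
  unfold kernel
  rw [Real.fourierInv_eq', Real.fourierInv_eq']
  simp only [one_mul]
  rw [← Complex.re_ofReal_mul]
  unfold symbol at h1
  rw [h1, ← Complex.real_smul]

lemma kernel_pos {n : ℕ} {s : ℝ} (hs0 : 0 < s) (hs1 : s < 1) {t : ℝ} (ht : 0 < t) (x : E n) :
    0 < kernel s t x := by
  obtain ⟨η, h⟩ := exists_isStableLaw hs0 hs1
  obtain ⟨c, hc, hlow⟩ := h.exists_le_integral_gauss (n := n) hs0 hs1
  rw [kernel_eq_scale hs0 ht, h.kernel_one hs0]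
  set z := (t ^ (1 / (2 * s)))⁻¹ • x
  have hρ : 0 < 1 + ‖z‖ := by positivity
  have h1 := hlow z (1 + ‖z‖) (by linarith [norm_nonneg z]) (by linarith)
  have h2 : 0 < c * (1 + ‖z‖) ^ (-((n : ℝ) + 2 * s)) := by positivity
  have h3 := h2.trans_le h1
  positivity

lemma exists_kernel_one_taylor (n : ℕ) {s : ℝ} (hs0 : 0 < s) (hs1 : s < 1) :
    ∃ C : ℝ, 0 < C ∧ ∀ z : E n, ∃ L : E n →L[ℝ] ℝ, HasFDerivAt (kernel s 1) L z ∧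
      ∀ k : E n, ‖k‖ ≤ 1 →
        |kernel s 1 (z - k) - kernel s 1 z + L k| ≤ C * ‖k‖ ^ 2 * kernel s 1 z := by
  obtain ⟨η, h⟩ := exists_isStableLaw hs0 hs1
  obtain ⟨C, hC, hb⟩ := h.exists_integral_gauss_taylor (n := n) hs0 hs1
  refine ⟨C, hC, fun z => ⟨(-∫ τ, gauss τ z / (2 * τ) ∂η) • innerSL ℝ z, ?_⟩⟩
  have key : ∀ k : E n, ‖k‖ ≤ 1 →
      |kernel s 1 (z - k) - kernel s 1 z + ((-∫ τ, gauss τ z / (2 * τ) ∂η) • innerSL ℝ z) k|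
        ≤ C * ‖k‖ ^ 2 * kernel s 1 z := by
    intro k hk
    have := hb z k hk
    rw [h.kernel_one hs0, h.kernel_one hs0]
    simpa [sub_eq_add_neg] using this
  refine ⟨?_, key⟩
  -- Differentiability is a by-product: the quadratic estimate, applied to `-k`, identifies the
  -- linear term as the derivative.
  rw [hasFDerivAt_iff_isLittleO_nhds_zero]
  have hO : (fun k : E n => kernel s 1 (z + k) - kernel s 1 z
      - ((-∫ τ, gauss τ z / (2 * τ) ∂η) • innerSL ℝ z) k) =O[𝓝 0] fun k => ‖k‖ ^ 2 := by
    refine Asymptotics.IsBigO.of_bound (C * kernel s 1 z) ?_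
    filter_upwards [Metric.closedBall_mem_nhds (0 : E n) one_pos] with k hk
    have := key (-k) (by simpa using hk)
    rw [sub_neg_eq_add, map_neg, norm_neg, ← sub_eq_add_neg] at this
    rw [Real.norm_eq_abs, Real.norm_of_nonneg (sq_nonneg _)]
    linarith
  exact hO.trans_isLittleO (Asymptotics.isLittleO_norm_pow_id one_lt_two)

/-- Second order Taylor estimate for the fractional heat kernel, relative to the kernel. -/
lemma exists_kernel_taylor (n : ℕ) {s : ℝ} (hs0 : 0 < s) (hs1 : s < 1) :
    ∃ C : ℝ, 0 < C ∧ ∀ t : ℝ, 0 < t → ∀ x y : E n, ‖y‖ ≤ t ^ (1 / (2 * s)) →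
      |kernel s t (x - y) - kernel s t x + fderiv ℝ (kernel s t) x y|
        ≤ C * (‖y‖ / t ^ (1 / (2 * s))) ^ 2 * kernel s t x := by
  obtain ⟨C, hC, hb⟩ := exists_kernel_one_taylor n hs0 hs1
  refine ⟨C, hC, fun t ht x y hy => ?_⟩
  have hscale : (kernel s t : E n → ℝ)
      = fun x => ((t ^ (1 / (2 * s))) ^ n)⁻¹ * kernel s 1 ((t ^ (1 / (2 * s)))⁻¹ • x) :=
    funext fun x => kernel_eq_scale hs0 ht x
  set r := t ^ (1 / (2 * s)) with hr
  have hr0 : 0 < r := by positivity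
  obtain ⟨L, hL, hLb⟩ := hb (r⁻¹ • x)
  have hd : HasFDerivAt (kernel s t) ((r ^ n)⁻¹ • L.comp (r⁻¹ • ContinuousLinearMap.id ℝ (E n))) x := by
    rw [hscale]
    exact (hL.comp x ((hasFDerivAt_id x).const_smul r⁻¹)).const_mul _
  have hk : ‖r⁻¹ • y‖ = ‖y‖ / r := by
    rw [norm_smul, Real.norm_of_nonneg (by positivity)]; field_simp
  have h1 := hLb (r⁻¹ • y) (by rw [hk]; exact div_le_one_of_le₀ hy hr0.le)
  rw [hd.fderiv, hscale]
  simp only [smul_sub, smul_apply, ContinuousLinearMap.comp_apply,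
    ContinuousLinearMap.id_apply, smul_eq_mul]
  rw [← mul_sub, ← mul_add, abs_mul, abs_of_pos (by positivity), ← hk]
  calc _ ≤ (r ^ n)⁻¹ * (C * ‖r⁻¹ • y‖ ^ 2 * kernel s 1 (r⁻¹ • x)) := by gcongr
    _ = _ := by ring

/-! ### The fractional Laplacian of truncated plane waves -/

lemma symbol_le {n : ℕ} {s : ℝ} (hs0 : 0 < s) (hs1 : s < 1) (ξ : E n) :
    symbol s ξ ≤ 1 + (2 * Real.pi * ‖ξ‖) ^ 2 := by
  unfold symbol
  set x := 2 * Real.pi * ‖ξ‖ with hx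
  have hx0 : 0 ≤ x := by positivity
  rcases le_total x 1 with h | h
  · have := Real.rpow_le_one hx0 h (by positivity : 0 ≤ 2 * s)
    nlinarith
  · have := Real.rpow_le_rpow_of_exponent_le h (by push_cast; linarith : 2 * s ≤ (2 : ℕ))
    rw [Real.rpow_natCast] at this
    linarith

lemma integrable_cexp_mul {n : ℕ} {f : E n → ℂ} (hf : Integrable f) {c : E n → ℝ}
    (hc : Continuous c) : Integrable fun v => Complex.exp ((c v : ℂ) * Complex.I) * f v := by
  refine hf.mono ((by fun_prop : Continuous fun v => Complex.exp ((c v : ℂ) * Complex.I)).aestronglyMeasurable.mul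
    hf.aestronglyMeasurable) (.of_forall fun v => ?_)
  rw [norm_mul, Complex.norm_exp_ofReal_mul_I, one_mul]

lemma fourier_linear_comb {n : ℕ} {f g : E n → ℂ} (hf : Integrable f) (hg : Integrable g)
    (a b : ℂ) (ξ : E n) :
    𝓕 (fun y => a * f y + b * g y) ξ = a * 𝓕 f ξ + b * 𝓕 g ξ := by
  simp only [Real.fourier_eq', smul_eq_mul]
  have h1 := integrable_cexp_mul hf (c := fun v => -2 * Real.pi * inner ℝ v ξ) (by fun_prop)
  have h2 := integrable_cexp_mul hg (c := fun v => -2 * Real.pi * inner ℝ v ξ) (by fun_prop)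
  rw [← integral_const_mul, ← integral_const_mul, ← integral_add (h1.const_mul a) (h2.const_mul b)]
  congr 1; ext v; ring

lemma fourierInv_linear_comb {n : ℕ} {f g : E n → ℂ} (hf : Integrable f) (hg : Integrable g)
    (a b : ℂ) (ξ : E n) :
    𝓕⁻ (fun y => a * f y + b * g y) ξ = a * 𝓕⁻ f ξ + b * 𝓕⁻ g ξ := by
  simp only [Real.fourierInv_eq_fourier_neg, fourier_linear_comb hf hg]

lemma fracLaplacian_const_mul {n : ℕ} (s c : ℝ) (f : E n → ℝ) (x : E n) :
    fracLaplacian s (fun y => c * f y) x = c * fracLaplacian s f x := by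
  unfold fracLaplacian
  rw [← Complex.re_ofReal_mul]
  congr 1
  simp only [Real.fourier_eq', Real.fourierInv_eq', smul_eq_mul]
  rw [← integral_const_mul]
  congr 1; ext ξ
  have : ∀ v : E n, Complex.exp (((-2 * Real.pi * inner ℝ v ξ : ℝ) : ℂ) * Complex.I) * ((c * f v : ℝ) : ℂ)
      = (c : ℂ) * (Complex.exp (((-2 * Real.pi * inner ℝ v ξ : ℝ) : ℂ) * Complex.I) * (f v : ℂ)) := by
    intro v; push_cast; ring
  simp_rw [this]
  rw [integral_const_mul]
  ring

/-- A smooth cutoff function on `ℝⁿ`. -/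
structure IsCutoff {n : ℕ} (χ : E n → ℝ) : Prop where
  contDiff : ContDiff ℝ ∞ χ
  hasCompactSupport : HasCompactSupport χ
  nonneg : ∀ x, 0 ≤ χ x
  le_one : ∀ x, χ x ≤ 1
  zero : χ 0 = 1

lemma exists_isCutoff (n : ℕ) : ∃ χ : E n → ℝ, IsCutoff χ := by
  let f : ContDiffBump (0 : E n) := ⟨1, 2, one_pos, one_lt_two⟩
  exact ⟨f, f.contDiff, f.hasCompactSupport, fun x => f.nonneg, fun x => f.le_one,
    f.one_of_mem_closedBall (by simp [f.rIn_pos.le])⟩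

namespace IsCutoff

variable {n : ℕ} {χ : E n → ℝ}

/-- The Fourier transform of the cutoff. -/
def hat (χ : E n → ℝ) : E n → ℂ := 𝓕 (fun x => (χ x : ℂ))

lemma contDiff_ofReal (h : IsCutoff χ) : ContDiff ℝ ∞ fun x => (χ x : ℂ) :=
  Complex.ofRealCLM.contDiff.comp h.contDiff

lemma hasCompactSupport_ofReal (h : IsCutoff χ) : HasCompactSupport fun x => (χ x : ℂ) :=
  h.hasCompactSupport.comp_left (g := fun r : ℝ => (r : ℂ)) Complex.ofReal_zero

/-- The complex valued cutoff as a Schwartz function. -/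
def toSchwartz (h : IsCutoff χ) : SchwartzMap (E n) ℂ :=
  h.hasCompactSupport_ofReal.toSchwartzMap h.contDiff_ofReal

lemma hat_eq (h : IsCutoff χ) : hat χ = 𝓕 h.toSchwartz := rfl

lemma continuous_hat (h : IsCutoff χ) : Continuous (hat χ) := by
  rw [h.hat_eq]; exact SchwartzMap.continuous _

lemma integrable_hat (h : IsCutoff χ) : Integrable (hat χ) := by
  rw [h.hat_eq]; exact SchwartzMap.integrable _

lemma integral_hat (h : IsCutoff χ) : ∫ η, hat χ η = 1 := by
  have h1 := (h.contDiff_ofReal.continuous).fourierInv_fourier_eq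
    (h.toSchwartz.integrable (μ := volume)) h.integrable_hat
  have h2 := congrFun h1 0
  rw [Real.fourierInv_eq'] at h2
  simpa [h.zero, hat] using h2

lemma integrable_majorant (h : IsCutoff χ) (a : ℝ) :
    Integrable fun η => (1 + (2 * Real.pi * (a + ‖η‖)) ^ 2) * ‖hat χ η‖ := by
  rw [h.hat_eq]
  have h0 := (𝓕 h.toSchwartz).integrable_pow_mul volume 0
  have h1 := (𝓕 h.toSchwartz).integrable_pow_mul volume 1
  have h2 := (𝓕 h.toSchwartz).integrable_pow_mul volume 2
  have := ((h0.const_mul (1 + 4 * Real.pi ^ 2 * a ^ 2)).add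
    (h1.const_mul (8 * Real.pi ^ 2 * a))).add (h2.const_mul (4 * Real.pi ^ 2))
  refine this.congr (.of_forall fun η => ?_)
  simp only [Pi.add_apply]
  ring

/-- The symbol grows at most quadratically and `hat χ` decays rapidly, which yields a majorant
independent of `δ` and of the point `x`. -/
lemma norm_symbol_mul_hat_le {s : ℝ} (hs0 : 0 < s) (hs1 : s < 1) {δ : ℝ} (hδ0 : 0 ≤ δ)
    (hδ1 : δ ≤ 1) (ξ η : E n) :
    ‖(symbol s (ξ + δ • η) : ℂ) * hat χ η‖
      ≤ (1 + (2 * Real.pi * (‖ξ‖ + ‖η‖)) ^ 2) * ‖hat χ η‖ := by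
  rw [norm_mul, Complex.norm_real, Real.norm_of_nonneg (symbol_nonneg _ _)]
  have : ‖ξ + δ • η‖ ≤ ‖ξ‖ + ‖η‖ := by
    refine (norm_add_le _ _).trans ?_
    rw [norm_smul, Real.norm_of_nonneg hδ0]
    gcongr
    exact mul_le_of_le_one_left (norm_nonneg _) hδ1
  refine mul_le_mul_of_nonneg_right ((symbol_le hs0 hs1 _).trans ?_) (norm_nonneg _)
  gcongr

lemma integrable_symbol_mul_hat (h : IsCutoff χ) {s : ℝ} (hs0 : 0 < s) (hs1 : s < 1) {δ : ℝ}
    (hδ0 : 0 ≤ δ) (hδ1 : δ ≤ 1) (ξ : E n) :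
    Integrable fun η => (symbol s (ξ + δ • η) : ℂ) * hat χ η := by
  refine (h.integrable_majorant ‖ξ‖).mono' (Continuous.aestronglyMeasurable ?_)
    (.of_forall fun η => norm_symbol_mul_hat_le hs0 hs1 hδ0 hδ1 ξ η)
  have := continuous_symbol (n := n) hs0
  have := h.continuous_hat
  fun_prop

/-- The fractional Laplacian of the truncated plane wave `χ(δx) exp(2πi⟨x,ξ⟩)`. -/
def waveLaplacian (χ : E n → ℝ) (s δ : ℝ) (ξ x : E n) : ℂ :=
  ∫ η, Complex.exp (((2 * Real.pi * inner ℝ (ξ + δ • η) x : ℝ) : ℂ) * Complex.I)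
    * ((symbol s (ξ + δ • η) : ℂ) * hat χ η)

lemma norm_waveLaplacian_integrand_le {s : ℝ} (hs0 : 0 < s) (hs1 : s < 1) {δ : ℝ}
    (hδ0 : 0 ≤ δ) (hδ1 : δ ≤ 1) (ξ x η : E n) :
    ‖Complex.exp (((2 * Real.pi * inner ℝ (ξ + δ • η) x : ℝ) : ℂ) * Complex.I)
      * ((symbol s (ξ + δ • η) : ℂ) * hat χ η)‖
      ≤ (1 + (2 * Real.pi * (‖ξ‖ + ‖η‖)) ^ 2) * ‖hat χ η‖ := by
  rw [norm_mul, Complex.norm_exp_ofReal_mul_I, one_mul]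
  exact norm_symbol_mul_hat_le hs0 hs1 hδ0 hδ1 ξ η

lemma norm_waveLaplacian_le (h : IsCutoff χ) {s : ℝ} (hs0 : 0 < s) (hs1 : s < 1) {δ : ℝ}
    (hδ0 : 0 ≤ δ) (hδ1 : δ ≤ 1) (ξ x : E n) :
    ‖waveLaplacian χ s δ ξ x‖ ≤ ∫ η, (1 + (2 * Real.pi * (‖ξ‖ + ‖η‖)) ^ 2) * ‖hat χ η‖ :=
  norm_integral_le_of_norm_le (h.integrable_majorant _)
    (.of_forall fun η => norm_waveLaplacian_integrand_le hs0 hs1 hδ0 hδ1 ξ x η)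

lemma continuous_waveLaplacian (h : IsCutoff χ) {s : ℝ} (hs0 : 0 < s) (hs1 : s < 1) {δ : ℝ}
    (hδ0 : 0 ≤ δ) (hδ1 : δ ≤ 1) (ξ : E n) : Continuous (waveLaplacian χ s δ ξ) := by
  have h1 := continuous_symbol (n := n) hs0
  have h2 := h.continuous_hat
  refine continuous_of_dominated (fun x => Continuous.aestronglyMeasurable (by fun_prop))
    (fun x => .of_forall fun η => norm_waveLaplacian_integrand_le hs0 hs1 hδ0 hδ1 ξ x η)
    (h.integrable_majorant _) (.of_forall fun η => by fun_prop)

/-- As `δ → 0` the frequency `ξ + δη` concentrates at `ξ`, with total weight `∫ hat χ = χ(0) = 1`.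
-/
lemma tendsto_waveLaplacian (h : IsCutoff χ) {s : ℝ} (hs0 : 0 < s) (hs1 : s < 1) {δ : ℕ → ℝ}
    (hδ0 : ∀ N, 0 ≤ δ N) (hδ1 : ∀ N, δ N ≤ 1) (hδ : Tendsto δ atTop (𝓝 0)) (ξ x : E n) :
    Tendsto (fun N => waveLaplacian χ s (δ N) ξ x) atTop
      (𝓝 (Complex.exp (((2 * Real.pi * inner ℝ ξ x : ℝ) : ℂ) * Complex.I) * symbol s ξ)) := by
  have h1 := continuous_symbol (n := n) hs0
  have h2 := h.continuous_hat
  have key : Tendsto (fun N => waveLaplacian χ s (δ N) ξ x) atTop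
      (𝓝 (∫ η, Complex.exp (((2 * Real.pi * inner ℝ ξ x : ℝ) : ℂ) * Complex.I)
        * ((symbol s ξ : ℂ) * hat χ η))) := by
    refine tendsto_integral_of_dominated_convergence _
      (fun N => Continuous.aestronglyMeasurable (by fun_prop)) (h.integrable_majorant _)
      (fun N => .of_forall fun η =>
        norm_waveLaplacian_integrand_le hs0 hs1 (hδ0 N) (hδ1 N) ξ x η)
      (.of_forall fun η => ?_)
    have hc : Continuous fun d : ℝ =>
        Complex.exp (((2 * Real.pi * inner ℝ (ξ + d • η) x : ℝ) : ℂ) * Complex.I)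
          * ((symbol s (ξ + d • η) : ℂ) * hat χ η) := by fun_prop
    have := (hc.tendsto 0).comp hδ
    simpa [Function.comp_def] using this
  rw [integral_const_mul, integral_const_mul, h.integral_hat, mul_one] at key
  exact key

lemma fourier_wave {δ : ℝ} (hδ : 0 < δ) (ξ₀ ξ : E n) :
    𝓕 (fun y => Complex.exp (((2 * Real.pi * inner ℝ y ξ₀ : ℝ) : ℂ) * Complex.I)
      * (χ (δ • y) : ℂ)) ξ = ((δ ^ n)⁻¹ : ℝ) * hat χ (δ⁻¹ • (ξ - ξ₀)) := by
  have h1 := Measure.integral_comp_smul (volume : Measure (E n)) (fun w : E n =>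
    Complex.exp (((-2 * Real.pi * inner ℝ w (δ⁻¹ • (ξ - ξ₀)) : ℝ) : ℂ) * Complex.I) • (χ w : ℂ)) δ
  rw [finrank_euclideanSpace_fin, abs_of_pos (by positivity), ← Real.fourier_eq',
    Complex.real_smul] at h1
  rw [hat, ← h1, Real.fourier_eq']
  congr 1; ext y
  simp only [smul_eq_mul]
  rw [← mul_assoc, ← Complex.exp_add, real_inner_smul_left, real_inner_smul_right, inner_sub_right]
  congr 2
  have hδ' : (δ : ℂ) ≠ 0 := by exact_mod_cast hδ.ne'
  push_cast
  field_simp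
  ring

lemma integrable_symbol_mul_fourier_wave (h : IsCutoff χ) {s : ℝ} (hs0 : 0 < s) (hs1 : s < 1)
    {δ : ℝ} (hδ0 : 0 < δ) (hδ1 : δ ≤ 1) (ξ₀ : E n) :
    Integrable fun ξ => (symbol s ξ : ℂ) * (((δ ^ n)⁻¹ : ℝ) * hat χ (δ⁻¹ • (ξ - ξ₀))) := by
  have h1 := h.integrable_symbol_mul_hat hs0 hs1 hδ0.le hδ1 ξ₀
  have h2 := ((h1.comp_smul (inv_ne_zero hδ0.ne')).comp_sub_right ξ₀).const_mul
    (((δ ^ n)⁻¹ : ℝ) : ℂ)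
  refine h2.congr (.of_forall fun ξ => ?_)
  simp only
  rw [smul_inv_smul₀ hδ0.ne', add_sub_cancel]
  ring

lemma fourierInv_symbol_mul_fourier_wave {s : ℝ} {δ : ℝ} (hδ0 : 0 < δ) (ξ₀ x : E n) :
    𝓕⁻ (fun ξ => (symbol s ξ : ℂ) * (((δ ^ n)⁻¹ : ℝ) * hat χ (δ⁻¹ • (ξ - ξ₀)))) x
      = waveLaplacian χ s δ ξ₀ x := by
  have h1 := Measure.integral_comp_smul (volume : Measure (E n)) (fun w : E n =>
    Complex.exp (((2 * Real.pi * inner ℝ (ξ₀ + w) x : ℝ) : ℂ) * Complex.I)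
      * ((symbol s (ξ₀ + w) : ℂ) * hat χ (δ⁻¹ • (ξ₀ + w - ξ₀)))) δ
  rw [integral_add_left_eq_self (fun w : E n =>
    Complex.exp (((2 * Real.pi * inner ℝ w x : ℝ) : ℂ) * Complex.I)
      * ((symbol s w : ℂ) * hat χ (δ⁻¹ • (w - ξ₀)))) ξ₀, finrank_euclideanSpace_fin,
    abs_of_pos (by positivity), Complex.real_smul, ← integral_const_mul] at h1
  simp only [add_sub_cancel_left, inv_smul_smul₀ hδ0.ne'] at h1
  rw [waveLaplacian, h1, Real.fourierInv_eq']
  congr 1; ext ξ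
  simp only [smul_eq_mul]
  ring

/-- The truncated real wave `χ(δx) cos(2π⟨x,ξ⟩ + α)`. -/
def realWave (χ : E n → ℝ) (δ : ℝ) (ξ : E n) (α : ℝ) (x : E n) : ℝ :=
  χ (δ • x) * Real.cos (2 * Real.pi * inner ℝ x ξ + α)

lemma contDiff_realWave (h : IsCutoff χ) (δ : ℝ) (ξ : E n) (α : ℝ) :
    ContDiff ℝ ∞ (realWave χ δ ξ α) := by
  have h1 := h.contDiff
  have h2 : ContDiff ℝ ∞ fun x : E n => inner ℝ x ξ := contDiff_id.inner ℝ contDiff_const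
  unfold realWave
  fun_prop

lemma hasCompactSupport_comp_smul (h : IsCutoff χ) {δ : ℝ} (hδ : δ ≠ 0) :
    HasCompactSupport fun x => χ (δ • x) :=
  h.hasCompactSupport.comp_homeomorph (Homeomorph.smulOfNeZero δ hδ)

lemma hasCompactSupport_realWave (h : IsCutoff χ) {δ : ℝ} (hδ : δ ≠ 0) (ξ : E n) (α : ℝ) :
    HasCompactSupport (realWave χ δ ξ α) :=
  (h.hasCompactSupport_comp_smul hδ).mul_right

lemma abs_realWave_le (h : IsCutoff χ) (δ : ℝ) (ξ : E n) (α : ℝ) (x : E n) :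
    |realWave χ δ ξ α x| ≤ 1 := by
  rw [realWave, abs_mul, abs_of_nonneg (h.nonneg _)]
  exact mul_le_one₀ (h.le_one _) (abs_nonneg _) (Real.abs_cos_le_one _)

lemma tendsto_realWave (h : IsCutoff χ) {δ : ℕ → ℝ} (hδ : Tendsto δ atTop (𝓝 0)) (ξ : E n)
    (α : ℝ) (x : E n) : Tendsto (fun N => realWave χ (δ N) ξ α x) atTop
      (𝓝 (Real.cos (2 * Real.pi * inner ℝ x ξ + α))) := by
  have := h.contDiff.continuous
  have hc : Continuous fun d : ℝ => realWave χ d ξ α x := by unfold realWave; fun_prop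
  have := (hc.tendsto 0).comp hδ
  simpa [realWave, h.zero, Function.comp_def] using this

lemma integrable_wave (h : IsCutoff χ) {δ : ℝ} (hδ : δ ≠ 0) (ξ : E n) :
    Integrable fun y => Complex.exp (((2 * Real.pi * inner ℝ y ξ : ℝ) : ℂ) * Complex.I)
      * (χ (δ • y) : ℂ) := by
  refine integrable_cexp_mul (Integrable.ofReal ?_) (by fun_prop)
  refine Continuous.integrable_of_hasCompactSupport ?_ (h.hasCompactSupport_comp_smul hδ)
  have := h.contDiff.continuous
  fun_prop

lemma cos_eq_exp_add_exp (a α : ℝ) :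
    ((Real.cos (a + α) : ℝ) : ℂ) = Complex.exp (α * Complex.I) / 2 * Complex.exp (a * Complex.I)
      + Complex.exp (-(α * Complex.I)) / 2 * Complex.exp ((-a : ℝ) * Complex.I) := by
  rw [Complex.ofReal_cos, Complex.cos, div_mul_eq_mul_div, div_mul_eq_mul_div, ← Complex.exp_add,
    ← Complex.exp_add, ← add_div]
  push_cast
  ring_nf

lemma fracLaplacian_realWave (h : IsCutoff χ) {s : ℝ} (hs0 : 0 < s) (hs1 : s < 1)
    {δ : ℝ} (hδ0 : 0 < δ) (hδ1 : δ ≤ 1) (ξ : E n) (α : ℝ) (x : E n) :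
    fracLaplacian s (realWave χ δ ξ α) x
      = (Complex.exp (α * Complex.I) / 2 * waveLaplacian χ s δ ξ x
        + Complex.exp (-(α * Complex.I)) / 2 * waveLaplacian χ s δ (-ξ) x).re := by
  have h1 : ∀ y, ((realWave χ δ ξ α y : ℝ) : ℂ)
      = Complex.exp (α * Complex.I) / 2 *
          (Complex.exp (((2 * Real.pi * inner ℝ y ξ : ℝ) : ℂ) * Complex.I) * (χ (δ • y) : ℂ))
        + Complex.exp (-(α * Complex.I)) / 2 *
          (Complex.exp (((2 * Real.pi * inner ℝ y (-ξ) : ℝ) : ℂ) * Complex.I)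
            * (χ (δ • y) : ℂ)) := by
    intro y
    rw [realWave, Complex.ofReal_mul, cos_eq_exp_add_exp, inner_neg_right, mul_neg]
    ring
  unfold fracLaplacian
  simp_rw [h1, fourier_linear_comb (h.integrable_wave hδ0.ne' ξ) (h.integrable_wave hδ0.ne' (-ξ)),
    fourier_wave hδ0]
  rw [← fourierInv_symbol_mul_fourier_wave hδ0, ← fourierInv_symbol_mul_fourier_wave hδ0,
    ← fourierInv_linear_comb (h.integrable_symbol_mul_fourier_wave hs0 hs1 hδ0 hδ1 ξ)
      (h.integrable_symbol_mul_fourier_wave hs0 hs1 hδ0 hδ1 (-ξ))]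
  refine congrArg Complex.re (congrFun (congrArg 𝓕⁻ (funext fun y => ?_)) x)
  rw [symbol]
  ring

end IsCutoff

/-- Truncated waves: test functions that converge boundedly to a plane wave, along with their
fractional Laplacians. -/
lemma exists_truncated_waves {n : ℕ} {s : ℝ} (hs0 : 0 < s) (hs1 : s < 1) (ξ : E n) (α : ℝ) :
    ∃ (f : ℕ → E n → ℝ) (C : ℝ), 0 ≤ C ∧ (∀ N, ContDiff ℝ ∞ (f N)) ∧
      (∀ N, HasCompactSupport (f N)) ∧ (∀ N x, |f N x| ≤ 1) ∧
      (∀ x, Tendsto (fun N => f N x) atTop (𝓝 (Real.cos (2 * Real.pi * inner ℝ x ξ + α)))) ∧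
      (∀ N, Continuous (fracLaplacian s (f N))) ∧ (∀ N x, |fracLaplacian s (f N) x| ≤ C) ∧
      (∀ x, Tendsto (fun N => fracLaplacian s (f N) x) atTop
        (𝓝 (symbol s ξ * Real.cos (2 * Real.pi * inner ℝ x ξ + α)))) := by
  obtain ⟨χ, h⟩ := exists_isCutoff n
  set δ : ℕ → ℝ := fun N => 1 / ((N : ℝ) + 1) with hδdef
  have hδ0 : ∀ N, 0 < δ N := fun N => by positivity
  have hδ1 : ∀ N, δ N ≤ 1 := fun N => by
    rw [hδdef]; simp only; rw [div_le_one (by positivity)]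
    have : (0 : ℝ) ≤ N := N.cast_nonneg
    linarith
  have hδ : Tendsto δ atTop (𝓝 0) := tendsto_one_div_add_atTop_nhds_zero_nat
  have hlap : ∀ N, fracLaplacian s (IsCutoff.realWave χ (δ N) ξ α) = _ := fun N =>
    funext fun x => h.fracLaplacian_realWave hs0 hs1 (hδ0 N) (hδ1 N) ξ α x
  set B : E n → ℝ := fun ξ => ∫ η, (1 + (2 * Real.pi * (‖ξ‖ + ‖η‖)) ^ 2) * ‖IsCutoff.hat χ η‖ with hB
  have hB0 : ∀ ξ, 0 ≤ B ξ := fun ξ => integral_nonneg fun η => by positivity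
  refine ⟨fun N => IsCutoff.realWave χ (δ N) ξ α, 1 / 2 * B ξ + 1 / 2 * B (-ξ),
    by have := hB0 ξ; have := hB0 (-ξ); positivity,
    fun N => h.contDiff_realWave _ _ _, fun N => h.hasCompactSupport_realWave (hδ0 N).ne' _ _,
    fun N x => h.abs_realWave_le _ _ _ _, fun x => h.tendsto_realWave hδ ξ α x, fun N => ?_,
    fun N x => ?_, fun x => ?_⟩
  · rw [hlap]
    have h1 := h.continuous_waveLaplacian hs0 hs1 (hδ0 N).le (hδ1 N) ξ
    have h2 := h.continuous_waveLaplacian hs0 hs1 (hδ0 N).le (hδ1 N) (-ξ)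
    fun_prop
  · rw [hlap]
    refine (Complex.abs_re_le_norm _).trans ((norm_add_le _ _).trans ?_)
    have e1 : ‖Complex.exp (α * Complex.I) / 2‖ = 1 / 2 := by
      rw [norm_div, Complex.norm_exp_ofReal_mul_I]; simp
    have e2 : ‖Complex.exp (-(α * Complex.I)) / 2‖ = 1 / 2 := by
      rw [← neg_mul, ← Complex.ofReal_neg, norm_div, Complex.norm_exp_ofReal_mul_I]; simp
    rw [norm_mul, norm_mul, e1, e2]
    have b1 := h.norm_waveLaplacian_le hs0 hs1 (hδ0 N).le (hδ1 N) ξ x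
    have b2 := h.norm_waveLaplacian_le hs0 hs1 (hδ0 N).le (hδ1 N) (-ξ) x
    gcongr
  · simp only [hlap]
    have t1 := h.tendsto_waveLaplacian hs0 hs1 (fun N => (hδ0 N).le) hδ1 hδ ξ x
    have t2 := h.tendsto_waveLaplacian hs0 hs1 (fun N => (hδ0 N).le) hδ1 hδ (-ξ) x
    have t3 := (t1.const_mul (Complex.exp (α * Complex.I) / 2)).add
      (t2.const_mul (Complex.exp (-(α * Complex.I)) / 2))
    have t4 := (Complex.continuous_re.tendsto _).comp t3
    refine t4.trans (le_of_eq (congrArg 𝓝 ?_))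
    have hsym : symbol s (-ξ) = symbol s ξ := by simp [symbol]
    rw [hsym, ← Complex.ofReal_re (symbol s ξ * Real.cos _), Complex.ofReal_mul (symbol s ξ),
      real_inner_comm ξ x, IsCutoff.cos_eq_exp_add_exp, inner_neg_left, mul_neg]
    congr 1
    ring

/-! ### The weak ordinary differential equation of a Fourier mode -/

lemma contDiff_integral_of_contDiff {f : ℝ → ℝ} (hf : ContDiff ℝ ∞ f) :
    ContDiff ℝ ∞ fun t => ∫ r in (0 : ℝ)..t, f r := by
  have hd : ∀ t, HasDerivAt (fun t => ∫ r in (0 : ℝ)..t, f r) (f t) t := fun t =>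
    intervalIntegral.integral_hasDerivAt_right (hf.continuous.intervalIntegrable _ _)
      hf.continuous.stronglyMeasurable.stronglyMeasurableAtFilter hf.continuous.continuousAt
  refine contDiff_infty_iff_deriv.2 ⟨fun t => (hd t).differentiableAt, ?_⟩
  rwa [funext fun t => (hd t).deriv]

/-- Solvability of `θ' - mθ = ψ` on `(0,∞)` by a compactly supported `θ`. -/
lemma exists_solution_compactSupport (m : ℝ) {ψ : ℝ → ℝ} (hψ : ContDiff ℝ ∞ ψ)
    (hψc : HasCompactSupport ψ) :
    ∃ θ : ℝ → ℝ, ContDiff ℝ ∞ θ ∧ HasCompactSupport θ ∧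
      (∀ t, 0 < t → deriv θ t - m * θ t = ψ t) ∧
      θ 0 = -∫ t in Ioi 0, ψ t * Real.exp (-(m * t)) := by
  obtain ⟨T, hT0, hT⟩ : ∃ T : ℝ, 0 < T ∧ ∀ t, T ≤ t → ψ t = 0 := by
    obtain ⟨r, hr, hr'⟩ := hψc.isCompact.isBounded.subset_ball_lt 0 0
    refine ⟨r, hr, fun t ht => image_eq_zero_of_notMem_tsupport fun hmem => ?_⟩
    have := hr' hmem
    rw [Metric.mem_ball, dist_zero_right, Real.norm_eq_abs] at this
    linarith [le_abs_self t]
  set g : ℝ → ℝ := fun t => ψ t * Real.exp (-(m * t)) with hg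
  have hgs : ContDiff ℝ ∞ g := by rw [hg]; fun_prop
  set I : ℝ → ℝ := fun t => ∫ r in (0 : ℝ)..t, g r with hI
  have hIs : ContDiff ℝ ∞ I := contDiff_integral_of_contDiff hgs
  have hId : ∀ t, HasDerivAt I (g t) t := fun t =>
    intervalIntegral.integral_hasDerivAt_right (hgs.continuous.intervalIntegrable _ _)
      hgs.continuous.stronglyMeasurable.stronglyMeasurableAtFilter hgs.continuous.continuousAt
  set c : ℝ := ∫ t in Ioi 0, g t with hc
  have hIc : ∀ t, T ≤ t → I t = c := by
    intro t ht
    rw [hI, hc]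
    simp only
    rw [intervalIntegral.integral_of_le (by linarith)]
    refine (setIntegral_eq_of_subset_of_forall_sdiff_eq_zero measurableSet_Ioi Ioc_subset_Ioi_self
      fun r hr => ?_).symm
    have hr1 : t < r := by
      by_contra hcon
      exact hr.2 ⟨hr.1, not_lt.1 hcon⟩
    simp [hg, hT r (by linarith)]
  set κ : ℝ → ℝ := fun t => Real.smoothTransition (t + 2) with hκ
  have hκs : ContDiff ℝ ∞ κ := Real.smoothTransition.contDiff.comp (by fun_prop)
  have hκ1 : ∀ t, -1 ≤ t → κ t = 1 := fun t ht =>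
    Real.smoothTransition.one_of_one_le (by linarith)
  have hκ0 : ∀ t, t ≤ -2 → κ t = 0 := fun t ht =>
    Real.smoothTransition.zero_of_nonpos (by linarith)
  -- Variation of constants, normalised by `I t - c` so as to vanish beyond the support of `ψ`. The
  -- cutoff `κ` acts only at `t < -1`, where no equation is demanded.
  refine ⟨fun t => κ t * (Real.exp (m * t) * (I t - c)), by fun_prop, ?_, fun t ht => ?_, ?_⟩
  · refine HasCompactSupport.intro (isCompact_Icc (a := -2) (b := T)) fun t ht => ?_
    rcases lt_or_ge t (-2) with h | h
    · simp [hκ0 t h.le]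
    · have : T ≤ t := by
        by_contra hcon
        exact ht ⟨h, (not_le.1 hcon).le⟩
      simp [hIc t this]
  · have h1 : HasDerivAt (fun t => Real.exp (m * t) * (I t - c))
        (Real.exp (m * t) * (m * 1) * (I t - c) + Real.exp (m * t) * g t) t :=
      (((hasDerivAt_id t).const_mul m).exp).mul ((hId t).sub_const c)
    have h2 : (fun t => κ t * (Real.exp (m * t) * (I t - c)))
        =ᶠ[𝓝 t] fun t => Real.exp (m * t) * (I t - c) := by
      filter_upwards [lt_mem_nhds ht] with r hr
      rw [hκ1 r (by linarith), one_mul]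
    rw [h2.deriv_eq, h1.deriv]
    simp only
    rw [hκ1 t (by linarith)]
    have h3 : Real.exp (m * t) * g t = ψ t := by
      rw [hg]; simp only
      rw [mul_left_comm, ← Real.exp_add]; simp
    rw [h3]; ring
  · simp [hκ1 0 (by norm_num), hI]

/-- A function which weakly solves `W' = -mW`, `W(0) = W₀` is `exp (-mt) W₀`. -/
lemma ae_eq_exp_of_weak {m W₀ : ℝ} {W : ℝ → ℝ} (hW : ∀ T, 0 < T → IntegrableOn W (Ioo 0 T))
    (h : ∀ θ : ℝ → ℝ, ContDiff ℝ ∞ θ → HasCompactSupport θ →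
      (∫ t in Ioi 0, (deriv θ t - m * θ t) * W t) + θ 0 * W₀ = 0) :
    ∀ᵐ t : ℝ, 0 < t → W t = Real.exp (-(m * t)) * W₀ := by
  have hloc : LocallyIntegrableOn W (Ioi 0) := by
    intro t ht
    have ht : 0 < t := ht
    exact ⟨Ioo 0 (t + 1), mem_nhdsWithin_of_mem_nhds (Ioo_mem_nhds ht (by linarith)),
      hW (t + 1) (by linarith)⟩
  have hcont : Continuous fun t : ℝ => Real.exp (-(m * t)) * W₀ := by fun_prop
  have hloc2 : LocallyIntegrableOn (fun t => W t - Real.exp (-(m * t)) * W₀) (Ioi 0) :=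
    hloc.sub (hcont.locallyIntegrable.locallyIntegrableOn _)
  have key := isOpen_Ioi.ae_eq_zero_of_integral_contDiff_smul_eq_zero hloc2 fun ψ hψ hψc hsupp => by
    -- Solving the adjoint equation with source `ψ` turns the hypothesis into `∫ ψ W = W₀ ∫ ψ
    -- exp(-mt)` for arbitrary `ψ`.
    obtain ⟨θ, hθ, hθc, hθe, hθ0⟩ := exists_solution_compactSupport m hψ hψc
    have h1 := h θ hθ hθc
    rw [setIntegral_congr_fun measurableSet_Ioi
      (fun t ht => by simp only [hθe t ht] :
        EqOn (fun t => (deriv θ t - m * θ t) * W t) (fun t => ψ t * W t) (Ioi 0)), hθ0] at h1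
    have hzero : ∀ t ∉ Ioi (0 : ℝ), ψ t • (W t - Real.exp (-(m * t)) * W₀) = 0 := by
      intro t ht
      rw [image_eq_zero_of_notMem_tsupport fun hmem => ht (hsupp hmem), zero_smul]
    rw [← setIntegral_eq_integral_of_forall_compl_eq_zero hzero]
    have i1 : IntegrableOn (fun t => ψ t * W t) (Ioi 0) := by
      have h2 : IntegrableOn W (tsupport ψ) :=
        (hloc.mono_set hsupp).integrableOn_isCompact hψc.isCompact
      have h3 : IntegrableOn (fun t => ψ t * W t) (tsupport ψ) :=
        h2.continuousOn_mul hψ.continuous.continuousOn hψc.isCompact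
      have h4 : Integrable fun t => ψ t * W t :=
        (integrableOn_iff_integrable_of_support_subset
          ((support_mul_subset_left _ _).trans (subset_tsupport ψ))).1 h3
      exact h4.integrableOn
    have i2 : IntegrableOn (fun t => ψ t * Real.exp (-(m * t)) * W₀) (Ioi 0) := by
      refine Integrable.integrableOn (Continuous.integrable_of_hasCompactSupport ?_ ?_)
      · have := hψ.continuous; fun_prop
      · exact hψc.mul_right.mul_right
    have : ∀ t, ψ t • (W t - Real.exp (-(m * t)) * W₀)
        = ψ t * W t - ψ t * Real.exp (-(m * t)) * W₀ := by
      intro t; rw [smul_eq_mul]; ring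
    simp_rw [this]
    rw [integral_sub i1 i2, integral_mul_const]
    linarith
  filter_upwards [key] with t ht h0
  linarith [ht h0]

/-! ### Fourier modes of a weak solution -/

namespace IsWeakSolution

variable {n : ℕ} {s : ℝ} {u₀ : E n → ℝ} {u : ℝ → E n → ℝ}

lemma integrable_prod (hu : IsWeakSolution s u₀ u) {T : ℝ} (hT : 0 < T) :
    Integrable (uncurry u) (((volume : Measure ℝ).restrict (Ioo 0 T)).prod volume) := by
  have := hu.integrableOn T hT
  rwa [IntegrableOn, Measure.volume_eq_prod, ← Measure.prod_restrict, Measure.restrict_univ] at this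

lemma integrable_prod_mul_cos (hu : IsWeakSolution s u₀ u) {T : ℝ} (hT : 0 < T) (ξ : E n) (α : ℝ) :
    Integrable (fun q : ℝ × E n => u q.1 q.2 * Real.cos (2 * Real.pi * inner ℝ q.2 ξ + α))
      (((volume : Measure ℝ).restrict (Ioo 0 T)).prod volume) := by
  refine (hu.integrable_prod hT).mono ((hu.integrable_prod hT).aestronglyMeasurable.mul
    (Continuous.aestronglyMeasurable (by fun_prop))) (.of_forall fun q => ?_)
  rw [norm_mul]
  exact mul_le_of_le_one_right (norm_nonneg _) (Real.abs_cos_le_one _)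

/-- Plane waves are not compactly supported, so `θ(t)` times a truncated wave is tested and the
truncation removed by dominated convergence. Integrability of `u` on time slabs provides the
majorant. -/
lemma mode_weak (hu : IsWeakSolution s u₀ u) (hs0 : 0 < s) (hs1 : s < 1) (hu₀ : Integrable u₀)
    (ξ : E n) (α : ℝ) {θ : ℝ → ℝ} (hθ : ContDiff ℝ ∞ θ) (hθc : HasCompactSupport θ) :
    (∫ t in Ioi 0, (deriv θ t - symbol s ξ * θ t)
      * ∫ x, u t x * Real.cos (2 * Real.pi * inner ℝ x ξ + α))
      + θ 0 * ∫ x, u₀ x * Real.cos (2 * Real.pi * inner ℝ x ξ + α) = 0 := by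
  obtain ⟨f, C, hC, hfs, hfc, hf1, hflim, hLc, hLb, hLlim⟩ := exists_truncated_waves hs0 hs1 ξ α
  obtain ⟨T, hT0, hT⟩ : ∃ T : ℝ, 0 < T ∧ ∀ t, T ≤ t → θ t = 0 ∧ deriv θ t = 0 := by
    obtain ⟨r, hr, hr'⟩ := hθc.isCompact.isBounded.subset_ball_lt 0 0
    refine ⟨r, hr, fun t ht => ?_⟩
    have hmem : t ∉ tsupport θ := fun hmem => by
      have := hr' hmem
      rw [Metric.mem_ball, dist_zero_right, Real.norm_eq_abs] at this
      linarith [le_abs_self t]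
    exact ⟨image_eq_zero_of_notMem_tsupport hmem,
      notMem_support.1 fun h' => hmem (support_deriv_subset h')⟩
  have hθ' : Continuous (deriv θ) := hθ.continuous_deriv (by simp)
  obtain ⟨A, hA⟩ := hθ.continuous.bounded_above_of_compact_support hθc
  obtain ⟨B, hB⟩ := hθ'.bounded_above_of_compact_support hθc.deriv
  have hrestrict : ∀ F : ℝ → ℝ, (∀ t, T ≤ t → F t = 0) →
      ∫ t in Ioi 0, F t = ∫ t in Ioo 0 T, F t := by
    intro F hF
    refine setIntegral_eq_of_subset_of_forall_sdiff_eq_zero measurableSet_Ioi Ioo_subset_Ioi_self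
      fun t ht => hF t ?_
    by_contra hcon
    exact ht.2 ⟨ht.1, not_le.1 hcon⟩
  set ν := ((volume : Measure ℝ).restrict (Ioo 0 T)).prod (volume : Measure (E n)) with hν
  have huint := hu.integrable_prod hT0
  set G : ℕ → ℝ × E n → ℝ := fun N q => u q.1 q.2 *
    (deriv θ q.1 * f N q.2 - θ q.1 * fracLaplacian s (f N) q.2) with hG
  have hGm : ∀ N, AEStronglyMeasurable (G N) ν := fun N => by
    have := (hfs N).continuous
    have := hLc N
    have := hθ.continuous
    exact huint.aestronglyMeasurable.mul (Continuous.aestronglyMeasurable (by fun_prop))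
  have hGb : ∀ N q, ‖G N q‖ ≤ ‖uncurry u q‖ * (B + A * C) := by
    intro N q
    rw [hG]; simp only [norm_mul]
    refine mul_le_mul_of_nonneg_left ?_ (norm_nonneg _)
    refine (norm_sub_le _ _).trans (add_le_add ?_ ?_)
    · rw [norm_mul]
      exact (mul_le_of_le_one_right (norm_nonneg _) (hf1 N _)).trans (hB _)
    · rw [norm_mul]
      exact mul_le_mul (hA _) (hLb N _) (norm_nonneg _) ((norm_nonneg _).trans (hA 0))
  have hGi : ∀ N, Integrable (G N) ν := fun N =>
    (huint.norm.mul_const _).mono' (hGm N) (.of_forall (hGb N))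
  have hweak : ∀ N, ∫ q, G N q ∂ν + ∫ x, u₀ x * (θ 0 * f N x) = 0 := by
    intro N
    have h1 := hu.weak (fun q => θ q.1 * f N q.2)
      ((hθ.comp contDiff_fst).mul ((hfs N).comp contDiff_snd)) ?_
    · refine Eq.trans (congrArg₂ (· + ·) ?_ rfl) h1
      rw [integral_prod _ (hGi N), hrestrict]
      · simp only [hG]
        refine integral_congr_ae (.of_forall fun t => integral_congr_ae (.of_forall fun x => ?_))
        simp only
        rw [fracLaplacian_const_mul, deriv_mul_const (hθ.differentiable (by simp) t)]
      · intro t ht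
        refine integral_eq_zero_of_ae (.of_forall fun x => ?_)
        simp only [Pi.zero_apply]
        rw [fracLaplacian_const_mul, deriv_mul_const (hθ.differentiable (by simp) t),
          (hT t ht).1, (hT t ht).2]
        ring
    · refine HasCompactSupport.intro (hθc.isCompact.prod (hfc N).isCompact) fun q hq => ?_
      by_contra hcon
      exact hq ⟨subset_tsupport _ (left_ne_zero_of_mul hcon),
        subset_tsupport _ (right_ne_zero_of_mul hcon)⟩
  have hlim1 : Tendsto (fun N => ∫ q, G N q ∂ν) atTop (𝓝 (∫ q : ℝ × E n,
      (deriv θ q.1 - symbol s ξ * θ q.1)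
        * (u q.1 q.2 * Real.cos (2 * Real.pi * inner ℝ q.2 ξ + α)) ∂ν)) := by
    refine tendsto_integral_of_dominated_convergence _ hGm (huint.norm.mul_const (B + A * C))
      (fun N => .of_forall (hGb N)) (.of_forall fun q => ?_)
    have := (((hflim q.2).const_mul (deriv θ q.1)).sub
      ((hLlim q.2).const_mul (θ q.1))).const_mul (u q.1 q.2)
    convert this using 2
    ring
  have hlim2 : Tendsto (fun N => ∫ x, u₀ x * (θ 0 * f N x)) atTop
      (𝓝 (∫ x, u₀ x * (θ 0 * Real.cos (2 * Real.pi * inner ℝ x ξ + α)))) := by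
    refine tendsto_integral_of_dominated_convergence (fun x => ‖u₀ x‖ * ‖θ 0‖)
      (fun N => ?_) (hu₀.norm.mul_const _) (fun N => .of_forall fun x => ?_)
      (.of_forall fun x => ((hflim x).const_mul _).const_mul _)
    · have := (hfs N).continuous
      exact hu₀.aestronglyMeasurable.mul (Continuous.aestronglyMeasurable (by fun_prop))
    · rw [norm_mul, norm_mul]
      refine mul_le_mul_of_nonneg_left ?_ (norm_nonneg _)
      exact mul_le_of_le_one_right (norm_nonneg _) (hf1 N _)
  have hsum := hlim1.add hlim2
  simp_rw [hweak] at hsum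
  have hfin := tendsto_nhds_unique tendsto_const_nhds hsum
  have hGlim : Integrable (fun q : ℝ × E n => (deriv θ q.1 - symbol s ξ * θ q.1)
        * (u q.1 q.2 * Real.cos (2 * Real.pi * inner ℝ q.2 ξ + α))) ν := by
    have hθ0 := hθ.continuous
    refine (hu.integrable_prod_mul_cos hT0 ξ α).bdd_mul (c := B + |symbol s ξ| * A)
      (Continuous.aestronglyMeasurable (by fun_prop)) (.of_forall fun q => ?_)
    refine (norm_sub_le _ _).trans (add_le_add (hB _) ?_)
    rw [norm_mul, Real.norm_eq_abs]
    exact mul_le_mul_of_nonneg_left (hA _) (abs_nonneg _)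
  rw [integral_prod _ hGlim] at hfin
  rw [hrestrict]
  · rw [← integral_const_mul]
    refine Eq.trans (congrArg₂ (· + ·) ?_ ?_) hfin.symm
    · refine integral_congr_ae (.of_forall fun t => ?_)
      simp only
      rw [integral_const_mul]
    · refine integral_congr_ae (.of_forall fun x => ?_)
      simp only
      ring
  · intro t ht
    rw [(hT t ht).1, (hT t ht).2]; ring

lemma ae_mode_eq (hu : IsWeakSolution s u₀ u) (hs0 : 0 < s) (hs1 : s < 1) (hu₀ : Integrable u₀)
    (ξ : E n) (α : ℝ) :
    ∀ᵐ t : ℝ, 0 < t → ∫ x, u t x * Real.cos (2 * Real.pi * inner ℝ x ξ + α)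
      = Real.exp (-(symbol s ξ * t)) * ∫ x, u₀ x * Real.cos (2 * Real.pi * inner ℝ x ξ + α) :=
  ae_eq_exp_of_weak (fun _ hT => (hu.integrable_prod_mul_cos hT ξ α).integral_prod_left)
    fun _ hθ hθc => hu.mode_weak hs0 hs1 hu₀ ξ α hθ hθc

lemma ae_integrable (hu : IsWeakSolution s u₀ u) : ∀ᵐ t : ℝ, 0 < t → Integrable (u t) := by
  have h : ∀ N : ℕ, ∀ᵐ t : ℝ, t ∈ Ioo 0 ((N : ℝ) + 1) → Integrable (u t) := fun N =>
    (ae_restrict_iff' measurableSet_Ioo).1 (hu.integrable_prod (by positivity)).prod_right_ae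
  filter_upwards [ae_all_iff.2 h] with t ht h0
  obtain ⟨N, hN⟩ := exists_nat_gt t
  exact ht N ⟨h0, by linarith⟩

end IsWeakSolution

/-! ### Fourier transforms of integrable functions. -/

lemma fourier_ofReal_eq {n : ℕ} {f : E n → ℝ} (hf : Integrable f) (ξ : E n) :
    𝓕 (fun x => (f x : ℂ)) ξ
      = ((∫ x, f x * Real.cos (2 * Real.pi * inner ℝ x ξ + 0) : ℝ) : ℂ)
        + ((∫ x, f x * Real.cos (2 * Real.pi * inner ℝ x ξ + Real.pi / 2) : ℝ) : ℂ) * Complex.I := by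
  have hint : ∀ α : ℝ, Integrable fun x => f x * Real.cos (2 * Real.pi * inner ℝ x ξ + α) := by
    intro α
    refine hf.mono (hf.aestronglyMeasurable.mul (Continuous.aestronglyMeasurable (by fun_prop)))
      (.of_forall fun q => ?_)
    rw [norm_mul]
    exact mul_le_of_le_one_right (norm_nonneg _) (Real.abs_cos_le_one _)
  rw [← integral_complex_ofReal, ← integral_complex_ofReal, ← integral_mul_const,
    ← integral_add (hint 0).ofReal ((hint _).ofReal.mul_const _), Real.fourier_eq']
  congr 1; ext x
  rw [Real.cos_add_pi_div_two, add_zero, Complex.exp_mul_I, ← Complex.ofReal_cos,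
    ← Complex.ofReal_sin, smul_eq_mul]
  have : (-2 * Real.pi * inner ℝ x ξ : ℝ) = -(2 * Real.pi * inner ℝ x ξ) := by ring
  rw [this, Real.cos_neg, Real.sin_neg]
  push_cast
  ring

lemma continuous_fourier_of_integrable {n : ℕ} {f : E n → ℂ} (hf : Integrable f) :
    Continuous (𝓕 f) :=
  VectorFourier.fourierIntegral_continuous Real.continuous_fourierChar
    (by exact continuous_inner) hf

lemma norm_fourier_le_integral {n : ℕ} (f : E n → ℂ) (ξ : E n) : ‖𝓕 f ξ‖ ≤ ∫ x, ‖f x‖ :=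
  VectorFourier.norm_fourierIntegral_le_integral_norm _ _ _ _ _

/-! ### The solution as a convolution with the kernel -/

/-- The solution of the fractional heat equation through its Fourier transform. -/
def spectralSolution {n : ℕ} (s : ℝ) (u₀ : E n → ℝ) (t : ℝ) (x : E n) : ℂ :=
  𝓕⁻ (fun ξ => (Real.exp (-(t * symbol s ξ)) : ℂ) * 𝓕 (fun y => (u₀ y : ℂ)) ξ) x

section Spectral

variable {n : ℕ} {s : ℝ} {u₀ : E n → ℝ}

lemma integrable_exp_mul_fourier (hs0 : 0 < s) (hs1 : s < 1) (hu₀ : Integrable u₀) {t : ℝ}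
    (ht : 0 < t) :
    Integrable fun ξ => (Real.exp (-(t * symbol s ξ)) : ℂ) * 𝓕 (fun y => (u₀ y : ℂ)) ξ := by
  refine (integrable_exp_neg_symbol hs0 hs1 ht).ofReal.mul_bdd (c := ∫ x, ‖(u₀ x : ℂ)‖)
    (continuous_fourier_of_integrable hu₀.ofReal).aestronglyMeasurable
    (.of_forall fun ξ => norm_fourier_le_integral _ ξ)

lemma continuousOn_spectralSolution (hs0 : 0 < s) (hs1 : s < 1) (hu₀ : Integrable u₀) (x : E n) :
    ContinuousOn (fun t => spectralSolution s u₀ t x) (Ioi 0) := by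
  intro t₀ ht₀
  have ht₀ : 0 < t₀ := ht₀
  refine ContinuousAt.continuousWithinAt ?_
  have hc := continuous_fourier_of_integrable (hu₀.ofReal (𝕜 := ℂ))
  have hsy := continuous_symbol (n := n) hs0
  simp only [spectralSolution, Real.fourierInv_eq', smul_eq_mul]
  -- For `t > t₀/2` the integrand is dominated by its modulus at time `t₀/2`.
  refine continuousAt_of_dominated (bound := fun ξ =>
    ‖(Real.exp (-(t₀ / 2 * symbol s ξ)) : ℂ) * 𝓕 (fun y => (u₀ y : ℂ)) ξ‖)
    (.of_forall fun t => Continuous.aestronglyMeasurable (by fun_prop)) ?_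
    (integrable_exp_mul_fourier hs0 hs1 hu₀ (half_pos ht₀)).norm
    (.of_forall fun ξ => by fun_prop)
  filter_upwards [lt_mem_nhds (half_lt_self ht₀)] with t ht
  refine .of_forall fun ξ => ?_
  rw [norm_mul, Complex.norm_exp_ofReal_mul_I, one_mul, norm_mul, norm_mul, Complex.norm_real,
    Complex.norm_real, Real.norm_of_nonneg (Real.exp_pos _).le,
    Real.norm_of_nonneg (Real.exp_pos _).le]
  have := symbol_nonneg s ξ
  gcongr

lemma re_spectralSolution (hs0 : 0 < s) (hs1 : s < 1) (hu₀ : Integrable u₀) {t : ℝ}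
    (ht : 0 < t) (x : E n) :
    (spectralSolution s u₀ t x).re = ∫ y, kernel s t (x - y) * u₀ y := by
  have hE := integrable_exp_neg_symbol (n := n) hs0 hs1 ht
  have hsy := continuous_symbol (n := n) hs0
  have hprod : Integrable (fun q : E n × E n =>
      Complex.exp (((2 * Real.pi * inner ℝ q.1 (x - q.2) : ℝ) : ℂ) * Complex.I)
        * ((Real.exp (-(t * symbol s q.1)) : ℂ) * (u₀ q.2 : ℂ))) (volume.prod volume) := by
    have h1 := (hE.ofReal (𝕜 := ℂ)).mul_prod (hu₀.ofReal (𝕜 := ℂ))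
    refine h1.mono ((Continuous.aestronglyMeasurable (by fun_prop)).mul h1.aestronglyMeasurable)
      (.of_forall fun q => ?_)
    rw [norm_mul, Complex.norm_exp_ofReal_mul_I, one_mul]
    rfl
  have h2 : spectralSolution s u₀ t x = ∫ ξ, ∫ y,
      Complex.exp (((2 * Real.pi * inner ℝ ξ (x - y) : ℝ) : ℂ) * Complex.I)
        * ((Real.exp (-(t * symbol s ξ)) : ℂ) * (u₀ y : ℂ)) := by
    rw [spectralSolution, Real.fourierInv_eq']
    congr 1; ext ξ
    rw [Real.fourier_eq', smul_eq_mul, ← integral_const_mul, ← integral_const_mul]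
    congr 1; ext y
    have : ((2 * Real.pi * inner ℝ ξ (x - y) : ℝ) : ℂ) * Complex.I
        = ((2 * Real.pi * inner ℝ ξ x : ℝ) : ℂ) * Complex.I
          + ((-2 * Real.pi * inner ℝ y ξ : ℝ) : ℂ) * Complex.I := by
      rw [inner_sub_right, real_inner_comm ξ y]
      push_cast; ring
    rw [this, Complex.exp_add, smul_eq_mul]
    ring
  rw [h2, integral_integral_swap hprod]
  have h3 := integral_re (hprod.integral_prod_right)
  simp only [RCLike.re_to_complex] at h3
  rw [← h3]
  congr 1; ext y
  rw [kernel, Real.fourierInv_eq', mul_comm (Complex.re _), ← Complex.re_ofReal_mul, ← integral_const_mul]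
  congr 2; ext ξ
  rw [symbol, smul_eq_mul]
  ring

end Spectral

namespace IsWeakSolution

variable {n : ℕ} {s : ℝ} {u₀ : E n → ℝ} {u : ℝ → E n → ℝ}

/-- The exceptional null set of times depends on the frequency. A countable dense set of frequencies
gives one null set, and continuity in `ξ` covers the rest. -/
lemma ae_fourier_eq (hu : IsWeakSolution s u₀ u) (hs0 : 0 < s) (hs1 : s < 1)
    (hu₀ : Integrable u₀) :
    ∀ᵐ t : ℝ, 0 < t → 𝓕 (fun x => (u t x : ℂ))
      = fun ξ => (Real.exp (-(t * symbol s ξ)) : ℂ) * 𝓕 (fun y => (u₀ y : ℂ)) ξ := by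
  obtain ⟨D, hDc, hD⟩ := TopologicalSpace.exists_countable_dense (E n)
  have h : ∀ α : ℝ, ∀ᵐ t : ℝ, ∀ ξ ∈ D, 0 < t →
      ∫ x, u t x * Real.cos (2 * Real.pi * inner ℝ x ξ + α)
      = Real.exp (-(symbol s ξ * t)) * ∫ x, u₀ x * Real.cos (2 * Real.pi * inner ℝ x ξ + α) :=
    fun α => (ae_ball_iff hDc).2 fun ξ _ => hu.ae_mode_eq hs0 hs1 hu₀ ξ α
  filter_upwards [h 0, h (Real.pi / 2), hu.ae_integrable] with t h1 h2 hint ht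
  have hsy := continuous_symbol (n := n) hs0
  have hc := continuous_fourier_of_integrable (hu₀.ofReal (𝕜 := ℂ))
  refine Continuous.ext_on hD (continuous_fourier_of_integrable (hint ht).ofReal) (by fun_prop)
    fun ξ hξ => ?_
  rw [fourier_ofReal_eq (hint ht), fourier_ofReal_eq hu₀, h1 ξ hξ ht, h2 ξ hξ ht, mul_comm t]
  push_cast
  ring

lemma continuous_slice (hu : IsWeakSolution s u₀ u) {t : ℝ} (ht : 0 < t) : Continuous (u t) :=
  hu.continuousOn.comp_continuous (f := fun x : E n => (t, x)) (by fun_prop)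
    fun x => ⟨ht, mem_univ x⟩

/-- The weak solution is the convolution of the initial datum with the kernel. -/
theorem eq_integral_kernel (hu : IsWeakSolution s u₀ u) (hs0 : 0 < s) (hs1 : s < 1)
    (hu₀ : Integrable u₀) {t : ℝ} (ht : 0 < t) (x : E n) :
    u t x = ∫ y, kernel s t (x - y) * u₀ y := by
  have hae : ∀ᵐ t : ℝ, 0 < t → u t x = (spectralSolution s u₀ t x).re := by
    filter_upwards [hu.ae_fourier_eq hs0 hs1 hu₀, hu.ae_integrable] with t h1 h2 ht
    have h3 := Continuous.fourierInv_fourier_eq (f := fun x => (u t x : ℂ))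
      (Complex.continuous_ofReal.comp (hu.continuous_slice ht)) (h2 ht).ofReal
      (by rw [h1 ht]; exact integrable_exp_mul_fourier hs0 hs1 hu₀ ht)
    have h4 := congrFun h3 x
    rw [h1 ht] at h4
    rw [spectralSolution, h4, Complex.ofReal_re]
  have hc1 : ContinuousOn (fun t => u t x) (Ioi 0) :=
    hu.continuousOn.comp (f := fun t : ℝ => (t, x)) (by fun_prop) fun t ht => ⟨ht, mem_univ x⟩
  have hc2 : ContinuousOn (fun t => (spectralSolution s u₀ t x).re) (Ioi 0) :=
    Complex.continuous_re.comp_continuousOn (continuousOn_spectralSolution hs0 hs1 hu₀ x)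
  -- Both sides are continuous in `t` for fixed `x`, so equality at almost every time holds at every
  -- positive time.
  have := Measure.eqOn_open_of_ae_eq ((ae_restrict_iff' measurableSet_Ioi).2 hae) isOpen_Ioi
    hc1 hc2 ht
  exact this.trans (re_spectralSolution hs0 hs1 hu₀ ht x)

end IsWeakSolution

/-! ### Asymptotic expansion -/

section Kernel

variable {n : ℕ} {s t : ℝ}

lemma continuous_kernel (hs0 : 0 < s) (hs1 : s < 1) (ht : 0 < t) :
    Continuous (kernel s t : E n → ℝ) := by
  have h := continuous_fourier_of_integrable
    ((integrable_exp_neg_symbol (n := n) hs0 hs1 ht).ofReal (𝕜 := ℂ))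
  unfold kernel
  simp only [Real.fourierInv_eq_fourier_neg]
  exact Complex.continuous_re.comp (h.comp continuous_neg)

lemma abs_kernel_le (s t : ℝ) (x : E n) :
    |kernel s t x| ≤ ∫ ξ : E n, ‖((Real.exp (-(t * symbol s ξ)) : ℝ) : ℂ)‖ := by
  unfold kernel
  rw [Real.fourierInv_eq_fourier_neg]
  exact (Complex.abs_re_le_norm _).trans (norm_fourier_le_integral _ _)

end Kernel

lemma clm_apply_eq_sum {n : ℕ} (L : E n →L[ℝ] ℝ) (y : E n) :
    L y = ∑ i, y i * L (EuclideanSpace.single i 1) := by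
  conv_lhs => rw [← (EuclideanSpace.basisFun (Fin n) ℝ).sum_repr y]
  simp [map_sum]

lemma integrable_apply_mul {n : ℕ} {u₀ : E n → ℝ} (hu₀ : Integrable u₀) {R : ℝ}
    (hR : ∀ᵐ y : E n, R < ‖y‖ → u₀ y = 0) (i : Fin n) : Integrable fun y : E n => y i * u₀ y := by
  refine (hu₀.norm.const_mul R).mono' ((Continuous.aestronglyMeasurable (by fun_prop)).mul
    hu₀.aestronglyMeasurable) ?_
  filter_upwards [hR] with y hy
  rw [norm_mul]
  by_cases h : R < ‖y‖
  · simp [hy h]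
  · exact mul_le_mul_of_nonneg_right ((PiLp.norm_apply_le y i).trans (not_lt.1 h)) (norm_nonneg _)

/-- Expanding the derivative in coordinates, the part linear in `y` integrates to the first moments
and the constant part to the mass. -/
lemma remainder_eq_integral {n : ℕ} {s : ℝ} (hs0 : 0 < s) (hs1 : s < 1) {u₀ : E n → ℝ}
    (hu₀ : Integrable u₀) {R : ℝ} (hR : ∀ᵐ y : E n, R < ‖y‖ → u₀ y = 0) {u : ℝ → E n → ℝ}
    (hu : IsWeakSolution s u₀ u) {t : ℝ} (ht : 0 < t) (x : E n) :
    remainder s u₀ u t x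
      = ∫ y, (kernel s t (x - y) - kernel s t x + fderiv ℝ (kernel s t) x y) * u₀ y := by
  have hk := continuous_kernel (n := n) hs0 hs1 ht
  have i1 : Integrable fun y => kernel s t (x - y) * u₀ y :=
    hu₀.bdd_mul (Continuous.aestronglyMeasurable (by fun_prop))
      (.of_forall fun y => abs_kernel_le s t (x - y))
  have i2 : Integrable fun y => kernel s t x * u₀ y := hu₀.const_mul _
  have i3 : ∀ i ∈ Finset.univ, Integrable fun y : E n =>
      y i * u₀ y * fderiv ℝ (kernel s t) x (EuclideanSpace.single i 1) := fun i _ =>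
    (integrable_apply_mul hu₀ hR i).mul_const _
  have h : ∀ y : E n, (kernel s t (x - y) - kernel s t x + fderiv ℝ (kernel s t) x y) * u₀ y
      = kernel s t (x - y) * u₀ y - kernel s t x * u₀ y
        + ∑ i, y i * u₀ y * fderiv ℝ (kernel s t) x (EuclideanSpace.single i 1) := by
    intro y
    rw [clm_apply_eq_sum (fderiv ℝ (kernel s t) x) y, add_mul, sub_mul, Finset.sum_mul]
    congr 1
    exact Finset.sum_congr rfl fun i _ => by ring
  have hsplit := integral_add (i1.sub i2) (integrable_finsetSum _ i3)
  simp only [Pi.sub_apply] at hsplit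
  simp_rw [h]
  rw [hsplit, integral_sub i1 i2,
    integral_finsetSum _ i3, integral_const_mul, remainder,
    hu.eq_integral_kernel hs0 hs1 hu₀ ht x, mass, mul_comm (∫ y, u₀ y)]
  congr 1
  refine Finset.sum_congr rfl fun i _ => ?_
  rw [integral_mul_const, firstMoment, partialDeriv]

/-- The remainder is `O(t^(-1/s))` relative to the kernel. -/
lemma exists_abs_remainder_le {n : ℕ} {s : ℝ} (hs0 : 0 < s) (hs1 : s < 1) {u₀ : E n → ℝ}
    (hu₀ : Integrable u₀) (hsupp : ∃ R : ℝ, ∀ᵐ y : E n, R < ‖y‖ → u₀ y = 0) {u : ℝ → E n → ℝ}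
    (hu : IsWeakSolution s u₀ u) :
    ∃ K : ℝ, 0 ≤ K ∧ ∀ᶠ t : ℝ in atTop, 0 < t ∧ ∀ x : E n,
      |remainder s u₀ u t x| ≤ K * ((t ^ (1 / (2 * s)))⁻¹) ^ 2 * kernel s t x := by
  obtain ⟨R, hR⟩ := hsupp
  obtain ⟨C, hC, hT⟩ := exists_kernel_taylor n hs0 hs1
  refine ⟨C * R ^ 2 * ∫ y, ‖u₀ y‖, by positivity, ?_⟩
  have hr : Tendsto (fun t : ℝ => t ^ (1 / (2 * s))) atTop atTop :=
    tendsto_rpow_atTop (by positivity)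
  -- Once `t^(1/(2s)) ≥ R`, every relevant `y` lies in the range of the Taylor estimate.
  filter_upwards [eventually_gt_atTop 0, hr.eventually_ge_atTop R] with t ht htR
  refine ⟨ht, fun x => ?_⟩
  have hP := kernel_pos hs0 hs1 ht x
  rw [remainder_eq_integral hs0 hs1 hu₀ hR hu ht, ← Real.norm_eq_abs]
  set r := t ^ (1 / (2 * s)) with hr
  have hr0 : 0 < r := by positivity
  have hle : ∀ᵐ y : E n,
      ‖(kernel s t (x - y) - kernel s t x + fderiv ℝ (kernel s t) x y) * u₀ y‖
        ≤ C * R ^ 2 * r⁻¹ ^ 2 * kernel s t x * ‖u₀ y‖ := by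
    filter_upwards [hR] with y hy
    rw [norm_mul]
    by_cases h : R < ‖y‖
    · simp [hy h]
    · have h := not_lt.1 h
      refine mul_le_mul_of_nonneg_right ?_ (norm_nonneg _)
      rw [Real.norm_eq_abs]
      refine (hT t ht x y (h.trans htR)).trans ?_
      rw [← hr, div_eq_mul_inv, mul_pow, ← mul_assoc]
      gcongr
  refine (norm_integral_le_of_norm_le (hu₀.norm.const_mul _) hle).trans (le_of_eq ?_)
  rw [integral_const_mul]
  ring

end FractionalHeat

end

theorem theorem4 (n : ℕ) (hn : 1 ≤ n) (s : ℝ) (hs0 : 0 < s) (hs1 : s < 1)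
    (u₀ : FractionalHeat.E n → ℝ) (hu₀ : MeasureTheory.Integrable u₀)
    (hsupp : ∃ R : ℝ, ∀ᵐ y : FractionalHeat.E n, R < ‖y‖ → u₀ y = 0)
    (u : ℝ → FractionalHeat.E n → ℝ) (hu : FractionalHeat.IsWeakSolution s u₀ u) :
    TendstoUniformly
      (fun (t : ℝ) (x : FractionalHeat.E n) =>
        t ^ (1 / (2 * s)) * (|FractionalHeat.remainder s u₀ u t x| / FractionalHeat.kernel s t x))
      (fun _ => 0) Filter.atTop ∧
    ∀ ε : ℝ, 0 < ε → ∀ᶠ t : ℝ in Filter.atTop, ∀ x : FractionalHeat.E n,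
      |FractionalHeat.remainder s u₀ u t x|
        ≤ ε * t ^ (-(1 / (2 * s))) * FractionalHeat.kernel s t x := by
  obtain ⟨K, hK, hrem⟩ := FractionalHeat.exists_abs_remainder_le hs0 hs1 hu₀ hsupp hu
  -- Of the two factors `t^(-1/(2s))` in the remainder bound, one cancels the weight in the claim
  -- and the other tends to zero.
  have hlim : Filter.Tendsto (fun t : ℝ => K * (t ^ (1 / (2 * s)))⁻¹) Filter.atTop (nhds 0) := by
    have := (tendsto_inv_atTop_zero.comp
      (tendsto_rpow_atTop (show 0 < 1 / (2 * s) by positivity))).const_mul K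
    simpa using this
  have key : ∀ ε : ℝ, 0 < ε → ∀ᶠ t : ℝ in Filter.atTop, 0 < t ∧ ∀ x : FractionalHeat.E n,
      |FractionalHeat.remainder s u₀ u t x|
        ≤ ε * (t ^ (1 / (2 * s)))⁻¹ * FractionalHeat.kernel s t x := by
    intro ε hε
    filter_upwards [hrem, hlim.eventually_le_const hε] with t ht hle
    refine ⟨ht.1, fun x => (ht.2 x).trans ?_⟩
    have := ht.1
    refine mul_le_mul_of_nonneg_right ?_ (FractionalHeat.kernel_pos hs0 hs1 ht.1 x).le
    rw [pow_two, ← mul_assoc]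
    exact mul_le_mul_of_nonneg_right hle (by positivity)
  refine ⟨Metric.tendstoUniformly_iff.2 fun ε hε => ?_, fun ε hε => ?_⟩
  · filter_upwards [key (ε / 2) (half_pos hε)] with t ht x
    have ht0 := ht.1
    have hP := FractionalHeat.kernel_pos hs0 hs1 ht0 x
    have hr : 0 < t ^ (1 / (2 * s)) := by positivity
    rw [dist_zero_left, Real.norm_of_nonneg (by positivity)]
    refine lt_of_le_of_lt ?_ (half_lt_self hε)
    calc _ ≤ t ^ (1 / (2 * s)) * (ε / 2 * (t ^ (1 / (2 * s)))⁻¹) := by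
          gcongr
          rw [div_le_iff₀ hP]
          exact ht.2 x
      _ = ε / 2 := by field_simp
  · filter_upwards [key ε hε] with t ht x
    rw [Real.rpow_neg ht.1.le]
    exact ht.2 x
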